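/- Let $d\ge 0$, and let $C\subset\mathbb R^d$ be a closed strictly convex (i.e. line-free) convex cone with apex $0$ and nonempty interior which is an integer cone, i.e. the set of all nonnegative linear combinations of finitely many vectors of $\mathbb Z^d$. A set $A\subset C$ is called a *$C$-coconvex integer polytope* if $A=C\setminus(\Delta\cup\{0\})$ for some closed convex set $\Delta\subset C$ such that $C\setminus\Delta$ is bounded and nonempty and all vertices of $\Delta$ belong to $\mathbb Z^d$. For such sets put $A\oplus B=C\setminus((\Delta_A+\Delta_B)\cup\{0\})$, where $\Delta_A$, $\Delta_B$ are the unbounded connected components of $C\setminus A$, $C\setminus B$ (empty if there is none, which happens only for $d=0$), and $+$ is the Minkowski sum; for $m>0$ let $mA=\{ma: a\in A\}$. A convex integer polytope is the convex hull of a finite subset of $\mathbb Z^d$. Let $\mathcal R_c(\mathbb Z^d)$ be the smallest ring of subsets of $\mathbb R^d$ (closed under finite unions and set differences) containing all convex integer polytopes. Let $K$ be a field of characteristic zero (for example $\mathbb R$ or $\mathbb C$). A valuation on integer polytopes with values in $K$ is a finitely additive measure $\mu:\mathcal R_c(\mathbb Z^d)\to K$; it is polynomial of degree $\le k$ (where $k\ge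 0$ is an integer) if for every convex integer polytope $P$ the function $x\mapsto\mu(P+x)$ is a polynomial on $\mathbb Z^d$ of degree at most $k$. Let $\mu$ be a polynomial valuation of degree $\le k$ on integer polytopes, let $n\ge 1$, and let $A_1,\dots,A_n$ be $C$-coconvex integer polytopes. Then for all positive integers $m_1,\dots,m_n$ the set $m_1A_1\oplus\cdots\oplus m_nA_n$ belongs to $\mathcal R_c(\mathbb Z^d)$, so that the number $$E(m_1,\dots,m_n)=\mu(m_1A_1\oplus m_2A_2\oplus\cdots\oplus m_nA_n)$$ is defined, and there is a polynomial in $n$ variables with coefficients in $K$, of total degree at most $k+d$, whose value at $(m_1,\dots,m_n)$ equals $E(m_1,\dots,m_n)$ for all positive integers $m_1,\dots,m_n$. -/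

import Mathlib

open scoped Pointwise

namespace Coconvex

variable {d : ℕ}

/-- The inclusion of the lattice `ℤ^d` into `ℝ^d`. -/
def latticePoint (z : Fin d → ℤ) : Fin d → ℝ := fun i => (z i : ℝ)

/-- A convex integer polytope: the convex hull of finitely many points of `ℤ^d`
(equivalently, a convex polytope all of whose vertices are in `ℤ^d`). -/
def IsIntegerPolytope (P : Set (Fin d → ℝ)) : Prop :=
  ∃ S : Finset (Fin d → ℤ), P = convexHull ℝ (latticePoint '' (S : Set (Fin d → ℤ)))

/-- The smallest ring of subsets of `ℝ^d` that contains all convex integer polytopes. -/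
def integerPolytopeRing (d : ℕ) : Set (Set (Fin d → ℝ)) :=
  {X | ∀ R : Set (Set (Fin d → ℝ)), MeasureTheory.IsSetRing R →
    (∀ P, IsIntegerPolytope P → P ∈ R) → X ∈ R}

theorem isSetRing_integerPolytopeRing (d : ℕ) :
    MeasureTheory.IsSetRing (integerPolytopeRing d) where
  empty_mem := fun _ hR _ => hR.empty_mem
  union_mem := fun _ _ hs ht R hR hP => hR.union_mem (hs R hR hP) (ht R hR hP)
  sdiff_mem := fun _ _ hs ht R hR hP => hR.sdiff_mem (hs R hR hP) (ht R hR hP)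

/-- A valuation on integer polytopes with values in `K`: a finitely additive measure on the ring
of sets generated by the convex integer polytopes. -/
abbrev IntegerValuation (d : ℕ) (K : Type*) [Field K] :=
  MeasureTheory.AddContent K (integerPolytopeRing d)

/-- The valuation `μ` is polynomial of degree `≤ k`: for every convex integer polytope `P`, the
function `x ↦ μ (P + x)` is a polynomial on `ℤ^d` of (total) degree at most `k`. -/
def IntegerValuation.IsPolynomial {K : Type*} [Field K] (μ : IntegerValuation d K) (k : ℕ) :
    Prop :=
  ∀ P : Set (Fin d → ℝ), IsIntegerPolytope P →
    ∃ p : MvPolynomial (Fin d) K, p.totalDegree ≤ k ∧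
      ∀ x : Fin d → ℤ, μ (P + {latticePoint x}) = MvPolynomial.eval (fun i => (x i : K)) p

/-- `C` is a closed strictly convex (that is, line-free) cone with apex `0` and with nonempty
interior. -/
structure IsStrictlyConvexCone (C : PointedCone ℝ (Fin d → ℝ)) : Prop where
  isClosed : IsClosed (C : Set (Fin d → ℝ))
  lineFree : ∀ x ∈ C, -x ∈ C → x = 0
  interior_nonempty : (interior (C : Set (Fin d → ℝ))).Nonempty

/-- `C` is an integer cone: it is the set of all nonnegative linear combinations of finitely many
vectors of `ℤ^d`. -/
def IsIntegerCone (C : PointedCone ℝ (Fin d → ℝ)) : Prop :=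
  ∃ S : Finset (Fin d → ℤ), C = PointedCone.hull ℝ (latticePoint '' (S : Set (Fin d → ℤ)))

/-- `Δ` is a closed convex subset of `C` whose complement in `C` is bounded and nonempty. -/
structure IsCobounded (C : PointedCone ℝ (Fin d → ℝ)) (Δ : Set (Fin d → ℝ)) : Prop where
  subset : Δ ⊆ C
  isClosed : IsClosed Δ
  convex : Convex ℝ Δ
  isBounded_compl : Bornology.IsBounded ((C : Set (Fin d → ℝ)) \ Δ)
  compl_nonempty : ((C : Set (Fin d → ℝ)) \ Δ).Nonempty

/-- `A` is a `C`-coconvex integer polytope: `A = C \ (Δ ∪ {0})`, where `Δ` is a closed convex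
subset of `C` with bounded nonempty complement in `C`, all of whose vertices (extreme points) are
in `ℤ^d`. -/
def IsCoconvexIntegerPolytope (C : PointedCone ℝ (Fin d → ℝ)) (A : Set (Fin d → ℝ)) : Prop :=
  ∃ Δ : Set (Fin d → ℝ), IsCobounded C Δ ∧
    (∀ v ∈ Δ.extremePoints ℝ, ∃ z : Fin d → ℤ, v = latticePoint z) ∧
    A = (C : Set (Fin d → ℝ)) \ (Δ ∪ {0})

/-- `Δ_A`, the unbounded connected component of `C \ A`: the set of all points of `C \ A` whose
connected component in `C \ A` is unbounded. -/
def unboundedComponent (C : PointedCone ℝ (Fin d → ℝ)) (A : Set (Fin d → ℝ)) :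
    Set (Fin d → ℝ) :=
  {x | x ∈ (C : Set (Fin d → ℝ)) \ A ∧
    ¬ Bornology.IsBounded (connectedComponentIn ((C : Set (Fin d → ℝ)) \ A) x)}

/-- The coconvex sum `A ⊕ B = C \ ((Δ_A + Δ_B) ∪ {0})`. -/
def oplus (C : PointedCone ℝ (Fin d → ℝ)) (A B : Set (Fin d → ℝ)) : Set (Fin d → ℝ) :=
  (C : Set (Fin d → ℝ)) \ ((unboundedComponent C A + unboundedComponent C B) ∪ {0})

/-- The iterated coconvex sum `(⋯ ((A₀ ⊕ A₁) ⊕ A₂) ⊕ ⋯) ⊕ Aₙ` of `n + 1` sets. -/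
def bigOplus (C : PointedCone ℝ (Fin d → ℝ)) :
    (n : ℕ) → (Fin (n + 1) → Set (Fin d → ℝ)) → Set (Fin d → ℝ)
  | 0, A => A 0
  | n + 1, A => oplus C (bigOplus C n fun i => A i.castSucc) (A (Fin.last (n + 1)))

end Coconvex

/-!
A `C`-coconvex integer polytope is `A = C \ (Δ ∪ {0})` with `Δ = P + C` for an integer polytope
`P`, and a coconvex sum of dilates is `C \ (∑ mᵢ Δᵢ ∪ {0})` (`bigOplus_eq_sdiff`). The proof
expresses this set through Minkowski sums of convex integer polytopes and then uses polynomiality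
of `μ` on those.

*From coconvex to convex.* Let `Γ` be the convex hull of `0` and of generators of `C`. The polytope
`Pᵢ` can be chosen to contain a positive multiple of every generator; let `P'ᵢ` be the convex hull
of `Pᵢ` and `0`. For a large integer `R`, put `Bᵢ = P'ᵢ + R Γ` and `Dᵢ = Pᵢ + R Γ`. Then
`C \ ∑ mᵢ Δᵢ = (∑ mᵢ Bᵢ) \ (∑ mᵢ Dᵢ)` for all positive `mᵢ` (`exists_integerPolytopes_sdiff_eq`),
because a point of `∑ mᵢ Bᵢ` far from the apex can be rewritten, using the multiples of generators
in `Pᵢ`, as a point of `∑ mᵢ Dᵢ`. Hence `μ` of the coconvex sum is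
`μ (∑ mᵢ Bᵢ) - μ (∑ mᵢ Dᵢ) - μ {0}`.

*The convex case.* A finitely additive measure respects linear relations between indicator
functions (`addContent_relation`), and such relations between compact convex sets are preserved by
linear images, because the Euler characteristic of compact convex sets is well defined
(`image_relation`). Let `P` be the convex hull of `w` lattice points `v`. An inclusion-exclusion
relation between parts of a dilated simplex is pushed forward to
`∑_I (-1)^#I [∑_{i ∈ I} v i + (r - #I) P + Q] = 0` for `r ≥ w` (`dilate_recursion`). In terms of
the translations `T_v` and the step `S : a ↦ a + 1`, it says that `∏_v (S - T_v)` annihilates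
`(z, a) ↦ μ (a P + Q + z)`. As `T_v - 1` is nilpotent on polynomials of degree
`≤ k`, `(S - 1) ^ (w + k)` annihilates this function (`pow_apply_eq_zero`), so it is a polynomial in `a` of degree `< w + k`.
Applied to each summand in turn, this shows that `μ (∑ mᵢ Qᵢ)` is a polynomial in `m`.

*The degree.* The total degree is read off on the lines `t ↦ t m`, where it is the degree of
`t ↦ μ (t P)`. A second relation, coming from an affine dependency between the points
(`convexHull_relation`), writes the indicator function of `P` as an integral combination of those
of polytopes spanned by at most `d + 1` points, for which the bound `< w + k` gives `≤ d + k`.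
-/

namespace Coconvex

/-! ### Linear relations between indicator functions -/

/-- A finitely additive measure respects every linear relation between indicator functions, here
in a form relative to a set `Y` of the ring, which makes an induction on the number of sets work. -/
theorem addContent_relation_on {α ι K : Type*} [AddCommGroup K] {R : Set (Set α)}
    (hR : MeasureTheory.IsSetRing R) (μ : MeasureTheory.AddContent K R) (J : Finset ι)
    (X : ι → Set α) (hX : ∀ j ∈ J, X j ∈ R) (c : ι → ℤ) :
    ∀ (Y : Set α), Y ∈ R → ∀ c₀ : ℤ,
      (∀ x ∈ Y, c₀ + ∑ j ∈ J, (X j).indicator (fun _ => c j) x = 0) →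
      c₀ • μ Y + ∑ j ∈ J, c j • μ (Y ∩ X j) = 0 := by
  classical
  induction J using Finset.induction_on with
  | empty =>
    intro Y hY c₀ h
    rcases Y.eq_empty_or_nonempty with rfl | ⟨x, hx⟩
    · simp
    · have := h x hx
      simp at this
      simp [this]
  | insert j J hj ih =>
    intro Y hY c₀ h
    have hXj := hX j (Finset.mem_insert_self _ _)
    have hXJ : ∀ i ∈ J, X i ∈ R := fun i hi => hX i (Finset.mem_insert_of_mem hi)
    have h1 := ih hXJ (Y ∩ X j) (hR.inter_mem hY hXj) (c₀ + c j) (by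
      intro x hx
      have := h x hx.1
      rw [Finset.sum_insert hj, Set.indicator_of_mem hx.2] at this
      rw [← this]; ring)
    have h2 := ih hXJ (Y \ X j) (hR.sdiff_mem hY hXj) c₀ (by
      intro x hx
      have := h x hx.1
      rw [Finset.sum_insert hj, Set.indicator_of_notMem hx.2] at this
      rw [← this]; ring)
    have hsplit : ∀ Z ∈ R, μ Z = μ (Z ∩ X j) + μ (Z \ X j) := by
      intro Z hZ
      rw [← MeasureTheory.addContent_union hR (hR.inter_mem hZ hXj) (hR.sdiff_mem hZ hXj)
        (Set.disjoint_sdiff_inter.symm), Set.inter_union_sdiff]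
    have hi : ∀ i ∈ J, c i • μ (Y ∩ X i)
        = c i • μ (Y ∩ X j ∩ X i) + c i • μ ((Y \ X j) ∩ X i) := by
      intro i hi
      rw [hsplit _ (hR.inter_mem hY (hXJ i hi)), smul_add]
      rw [Set.inter_right_comm Y, ← Set.inter_sdiff_right_comm]
    rw [Finset.sum_insert hj, Finset.sum_congr rfl hi, Finset.sum_add_distrib, hsplit Y hY]
    rw [add_smul] at h1
    have := congrArg₂ (· + ·) h1 h2
    simp only [add_zero] at this
    rw [← this, smul_add]
    abel

/-- A finitely additive measure on a ring of sets respects linear relations between indicator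
functions. -/
theorem addContent_relation {α ι K : Type*} [AddCommGroup K] {R : Set (Set α)}
    (hR : MeasureTheory.IsSetRing R) (μ : MeasureTheory.AddContent K R) (J : Finset ι)
    (X : ι → Set α) (hX : ∀ j ∈ J, X j ∈ R) (c : ι → ℤ)
    (h : ∀ x, ∑ j ∈ J, (X j).indicator (fun _ => c j) x = 0) :
    ∑ j ∈ J, c j • μ (X j) = 0 := by
  have := addContent_relation_on hR μ J X hX c (⋃ j ∈ J, X j) (hR.biUnion_mem J hX) 0
    (by intro x _; simpa using h x)
  rw [zero_smul, zero_add] at this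
  rw [← this]
  refine Finset.sum_congr rfl fun j hj => ?_
  have hsub : X j ⊆ ⋃ j ∈ J, X j := Set.subset_biUnion_of_mem (u := X) (Finset.mem_coe.2 hj)
  rw [Set.inter_eq_right.2 hsub]

/-! ### The Euler characteristic of compact convex sets -/

open scoped Topology in
/-- The Euler characteristic on the line: the jump of `∑ c j • 1_[a j, b j]` to the right of `b`
is the sum of the `c j` with `b j = b`. -/
theorem sum_eq_zero_of_sum_indicator_Icc {ι : Type*} (J : Finset ι) (a b : ι → ℝ)
    (hab : ∀ j ∈ J, a j ≤ b j) (c : ι → ℤ)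
    (h : ∀ x, ∑ j ∈ J, (Set.Icc (a j) (b j)).indicator (fun _ => c j) x = 0) :
    ∑ j ∈ J, c j = 0 := by
  classical
  rw [← Finset.sum_fiberwise_of_maps_to (s := J) (t := J.image b) (g := b)
    (fun j hj => Finset.mem_image_of_mem _ hj)]
  refine Finset.sum_eq_zero fun y _ => ?_
  have hev : ∀ᶠ x in 𝓝[>] y, ∀ j ∈ J, (x ∈ Set.Icc (a j) (b j) ↔ a j ≤ y ∧ y < b j) := by
    rw [Filter.eventually_all_finset]
    intro j hj
    have hy : ∀ᶠ x in 𝓝[>] y, y < x := eventually_mem_nhdsWithin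
    rcases lt_or_ge y (a j) with h1 | h1
    · filter_upwards [nhdsWithin_le_nhds (eventually_lt_nhds h1)] with x hx
      simp only [Set.mem_Icc]
      exact ⟨fun h => absurd h.1 (not_le.2 hx), fun h => absurd h.1 (not_le.2 h1)⟩
    rcases lt_or_ge y (b j) with h2 | h2
    · filter_upwards [nhdsWithin_le_nhds (eventually_lt_nhds h2), hy] with x hx hx'
      simp only [Set.mem_Icc]
      exact ⟨fun _ => ⟨h1, h2⟩, fun _ => ⟨h1.trans hx'.le, hx.le⟩⟩
    · filter_upwards [hy] with x hx'
      simp only [Set.mem_Icc]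
      exact ⟨fun h => absurd h.2 (not_le.2 (h2.trans_lt hx')), fun h => absurd h.2 (not_lt.2 h2)⟩
  obtain ⟨x, hx⟩ := hev.exists
  have h1 := h y
  have h2 := h x
  refine Eq.trans ?_ (sub_eq_zero.2 (h1.trans h2.symm))
  rw [Finset.sum_filter, ← Finset.sum_sub_distrib]
  refine Finset.sum_congr rfl fun j hj => ?_
  have := hab j hj
  simp only [Set.indicator_apply, hx j hj]
  simp only [Set.mem_Icc]
  grind

/-- The Euler characteristic of compact convex sets is well defined: in a linear relation between
their indicator functions, the coefficients of the nonempty sets add up to zero. The induction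
slices along a list of linear functionals that separates the points of the sets. -/
theorem euler_relation_of_separating {E : Type*} [AddCommGroup E] [Module ℝ E]
    [TopologicalSpace E] [IsTopologicalAddGroup E] [ContinuousSMul ℝ E] {ι : Type*}
    (J : Finset ι) (c : ι → ℤ) (l : List (E →L[ℝ] ℝ)) :
    ∀ X : ι → Set E, (∀ j ∈ J, IsCompact (X j)) → (∀ j ∈ J, Convex ℝ (X j)) →
      (∀ i ∈ J, ∀ j ∈ J, ∀ x ∈ X i, ∀ y ∈ X j, (∀ f ∈ l, f x = f y) → x = y) →
      (∀ x, ∑ j ∈ J, (X j).indicator (fun _ => c j) x = 0) →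
      ∑ j ∈ J, {_u : Unit | (X j).Nonempty}.indicator (fun _ => c j) () = 0 := by
  classical
  induction l with
  | nil =>
    intro X _ _ hsep h
    by_cases hne : ∃ j ∈ J, (X j).Nonempty
    · obtain ⟨j₀, hj₀, x, hx⟩ := hne
      rw [← h x]
      refine Finset.sum_congr rfl fun j hj => ?_
      have : (X j).Nonempty ↔ x ∈ X j :=
        ⟨fun ⟨y, hy⟩ => by rwa [hsep j₀ hj₀ j hj x hx y hy (by simp)], fun h => ⟨x, h⟩⟩
      simp [Set.indicator_apply, this]
    · push Not at hne
      refine Finset.sum_eq_zero fun j hj => ?_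
      simp [hne j hj]
  | cons f l ih =>
    intro X hcomp hconv hsep h
    have hslice : ∀ t : ℝ,
        ∑ j ∈ J, (f '' X j).indicator (fun _ => c j) t = 0 := by
      intro t
      have := ih (fun j => X j ∩ f ⁻¹' {t})
        (fun j hj => (hcomp j hj).inter_right (isClosed_singleton.preimage f.continuous))
        (fun j hj => (hconv j hj).inter ((convex_singleton t).linear_preimage f.toLinearMap))
        (by
          intro i hi j hj x hx y hy hxy
          refine hsep i hi j hj x hx.1 y hy.1 fun g hg => ?_
          rcases List.mem_cons.1 hg with rfl | hg
          · exact (hx.2 : _ = t).trans (hy.2 : _ = t).symm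
          · exact hxy g hg)
        (by
          intro x
          by_cases hx : f x = t
          · rw [← h x]
            refine Finset.sum_congr rfl fun j _ => ?_
            simp [Set.indicator_apply, hx]
          · refine Finset.sum_eq_zero fun j _ => ?_
            simp [hx])
      rw [← this]
      refine Finset.sum_congr rfl fun j _ => ?_
      have : t ∈ f '' X j ↔ (X j ∩ f ⁻¹' {t}).Nonempty := by
        simp only [Set.mem_image, Set.Nonempty, Set.mem_inter_iff, Set.mem_preimage,
          Set.mem_singleton_iff]
      simp [Set.indicator_apply, this]
    have hIcc : ∀ j ∈ J, (X j).Nonempty → f '' X j = Set.Icc (sInf (f '' X j)) (sSup (f '' X j)) :=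
      fun j hj hne => eq_Icc_of_connected_compact
        ⟨hne.image f, ((hconv j hj).isPreconnected.image f f.continuous.continuousOn)⟩
        ((hcomp j hj).image f.continuous)
    simp only [Set.indicator_apply, Set.mem_ofPred_eq]
    rw [← Finset.sum_filter]
    refine sum_eq_zero_of_sum_indicator_Icc _ (fun j => sInf (f '' X j))
      (fun j => sSup (f '' X j)) ?_ c ?_
    · intro j hj
      obtain ⟨hj, hne⟩ := Finset.mem_filter.1 hj
      have := hne.image f
      rw [hIcc j hj hne] at this
      exact Set.nonempty_Icc.1 this
    · intro t
      rw [← hslice t, Finset.sum_filter]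
      refine Finset.sum_congr rfl fun j hj => ?_
      split_ifs with hne
      · rw [← hIcc j hj hne]
      · rw [Set.not_nonempty_iff_eq_empty.1 hne]; simp

/-- The push-forward of indicator functions of compact convex sets along a linear map (with
respect to the Euler characteristic) is well defined. -/
theorem image_relation {E F : Type*} [NormedAddCommGroup E] [NormedSpace ℝ E]
    [FiniteDimensional ℝ E] [NormedAddCommGroup F] [NormedSpace ℝ F] {ι : Type*}
    (J : Finset ι) (c : ι → ℤ) (X : ι → Set E)
    (hcomp : ∀ j ∈ J, IsCompact (X j)) (hconv : ∀ j ∈ J, Convex ℝ (X j))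
    (h : ∀ x, ∑ j ∈ J, (X j).indicator (fun _ => c j) x = 0) (f : E →L[ℝ] F) (y : F) :
    ∑ j ∈ J, (f '' X j).indicator (fun _ => c j) y = 0 := by
  classical
  let b := Module.finBasis ℝ E
  have := euler_relation_of_separating J c
    (List.ofFn fun i => (LinearMap.toContinuousLinearMap (b.coord i) : E →L[ℝ] ℝ))
    (fun j => X j ∩ f ⁻¹' {y})
    (fun j hj => (hcomp j hj).inter_right (isClosed_singleton.preimage f.continuous))
    (fun j hj => (hconv j hj).inter ((convex_singleton y).linear_preimage f.toLinearMap))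
    (by
      intro i _ j _ x _ z _ hxz
      refine b.ext_elem fun i => ?_
      simpa using hxz _ (List.mem_ofFn.2 ⟨i, rfl⟩))
    (by
      intro x
      by_cases hx : f x = y
      · rw [← h x]
        refine Finset.sum_congr rfl fun j _ => ?_
        simp [Set.indicator_apply, hx]
      · refine Finset.sum_eq_zero fun j _ => ?_
        simp [hx])
  rw [← this]
  refine Finset.sum_congr rfl fun j _ => ?_
  have : y ∈ f '' X j ↔ (X j ∩ f ⁻¹' {y}).Nonempty := by
    simp only [Set.mem_image, Set.Nonempty, Set.mem_inter_iff, Set.mem_preimage,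
      Set.mem_singleton_iff]
  simp [Set.indicator_apply, this]

/-! ### Operators that become nilpotent -/

section Operators

variable {K M ι : Type*} [Field K] [AddCommGroup M] [Module K M]

/-- `f` is annihilated by every product of `n` operators of the family `t`. -/
def KilledBy (t : ι → Module.End K M) : ℕ → M → Prop
  | 0, f => f = 0
  | n + 1, f => ∀ i, KilledBy t n (t i f)

theorem KilledBy.zero (t : ι → Module.End K M) (n : ℕ) : KilledBy t n 0 := by
  induction n with
  | zero => rfl
  | succ n ih => intro i; rw [map_zero]; exact ih

theorem KilledBy.add {t : ι → Module.End K M} {n : ℕ} {f g : M} (hf : KilledBy t n f)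
    (hg : KilledBy t n g) : KilledBy t n (f + g) := by
  induction n generalizing f g with
  | zero => rw [KilledBy] at *; rw [hf, hg, add_zero]
  | succ n ih => intro i; rw [map_add]; exact ih (hf i) (hg i)

theorem KilledBy.sum {α : Type*} {t : ι → Module.End K M} {n : ℕ} (s : Finset α) {f : α → M}
    (hf : ∀ a ∈ s, KilledBy t n (f a)) : KilledBy t n (∑ a ∈ s, f a) := by
  classical
  induction s using Finset.induction_on with
  | empty => exact KilledBy.zero t n
  | insert a s ha ih =>
    rw [Finset.sum_insert ha]
    exact (hf a (Finset.mem_insert_self _ _)).add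
      (ih fun b hb => hf b (Finset.mem_insert_of_mem hb))

theorem KilledBy.succ {t : ι → Module.End K M} {n : ℕ} {f : M} (hf : KilledBy t n f) :
    KilledBy t (n + 1) f := by
  induction n generalizing f with
  | zero => rw [KilledBy] at hf; rw [hf]; exact KilledBy.zero t 1
  | succ n ih => exact fun i => ih (hf i)

theorem KilledBy.mono {t : ι → Module.End K M} {m n : ℕ} (hmn : m ≤ n) {f : M}
    (hf : KilledBy t m f) : KilledBy t n f := by
  induction hmn with
  | refl => exact hf
  | step _ ih => exact ih.succ

theorem KilledBy.map {t : ι → Module.End K M} {n : ℕ} {f : M} (hf : KilledBy t n f)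
    {y : Module.End K M} (hy : ∀ i, Commute y (t i)) : KilledBy t n (y f) := by
  induction n generalizing f with
  | zero => rw [KilledBy] at *; rw [hf, map_zero]
  | succ n ih =>
    intro i
    rw [← Module.End.mul_apply, ← (hy i).eq, Module.End.mul_apply]
    exact ih (hf i)

/-- If a product of `w` factors `x - t i` annihilates `f`, and so does every product of `n`
operators `t i`, then `x ^ (w + n - 1)` annihilates `f` (which is `0` if `w` or `n` is `0`): one
factor `x` at a time is traded for a factor `t i`. -/
theorem pow_apply_eq_zero {x : Module.End K M} {t : ι → Module.End K M}
    (hx : ∀ i, Commute x (t i)) (ht : ∀ i j, Commute (t i) (t j)) (n : ℕ) :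
    ∀ (l : List ι) (f : M), KilledBy t n f → (l.map fun i => x - t i).prod f = 0 →
      (x ^ (l.length + n - 1)) f = 0 := by
  induction n with
  | zero => intro l f hf _; rw [KilledBy] at hf; rw [hf, map_zero]
  | succ n ihn =>
    intro l
    induction l with
    | nil =>
      intro f _ h
      rw [List.map_nil, List.prod_nil, Module.End.one_apply] at h
      rw [h, map_zero]
    | cons i l ihl =>
      intro f hf h
      have hcomm : ∀ j, Commute (x - t j) ((l.map fun i => x - t i).prod) := fun j =>
        Commute.list_prod_right _ _ fun z hz => by
          obtain ⟨k, -, rfl⟩ := List.mem_map.1 hz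
          exact ((Commute.refl x).sub_right (hx k)).sub_left (((hx j).symm).sub_right (ht j k))
      have hcomm' : ∀ j, Commute (t j) (((i :: l).map fun i => x - t i).prod) := fun j =>
        Commute.list_prod_right _ _ fun z hz => by
          obtain ⟨k, -, rfl⟩ := List.mem_map.1 hz
          exact ((hx j).symm).sub_right (ht j k)
      have h1 := ihl ((x - t i) f) (hf.map fun j => (hx j).sub_left (ht i j)) (by
        rw [← Module.End.mul_apply, ← (hcomm i).eq]
        simpa using h)
      have h2 := ihn (i :: l) (t i f) (hf i) (by
        rw [← Module.End.mul_apply, ← (hcomm' i).eq, Module.End.mul_apply, h, map_zero])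
      have e1 : l.length + (n + 1) - 1 = l.length + n := by omega
      have e2 : (i :: l).length + n - 1 = l.length + n := by rw [List.length_cons]; omega
      have e3 : (i :: l).length + (n + 1) - 1 = l.length + n + 1 := by rw [List.length_cons]; omega
      rw [e1, LinearMap.sub_apply, map_sub, sub_eq_zero] at h1
      rw [e2] at h2
      rw [e3, pow_succ, Module.End.mul_apply, h1, h2]

end Operators

/-! ### Difference operators -/

section Differences

variable {K : Type*} [Field K] {G : Type*} [AddCommGroup G]

/-- The difference operator `f ↦ f (· + v) - f` on functions on a group. -/
def diffOp (K : Type*) [Field K] (v : G) : Module.End K (G → K) where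
  toFun f := fun z => f (z + v) - f z
  map_add' f g := by ext z; simp; ring
  map_smul' c f := by ext z; simp; ring

theorem diffOp_apply (v : G) (f : G → K) (z : G) : diffOp K v f z = f (z + v) - f z := rfl

theorem KilledBy.mul {a b : ℕ} {f g : G → K} (hf : KilledBy (diffOp K) a f)
    (hg : KilledBy (diffOp K) b g) : KilledBy (diffOp K) (a + b - 1) (f * g) := by
  induction h : a + b generalizing a b f g with
  | zero =>
    obtain rfl : a = 0 := by omega
    rw [KilledBy] at hf; rw [hf, zero_mul]; exact KilledBy.zero _ _
  | succ s ih =>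
    match a, b with
    | 0, _ => rw [KilledBy] at hf; rw [hf, zero_mul]; exact KilledBy.zero _ _
    | _, 0 => rw [KilledBy] at hg; rw [hg, mul_zero]; exact KilledBy.zero _ _
    | a + 1, b + 1 =>
      obtain rfl : s = a + b + 1 := by omega
      intro v
      have e : diffOp K v (f * g)
          = diffOp K v f * g + f * diffOp K v g + diffOp K v f * diffOp K v g := by
        ext z; simp only [diffOp_apply, Pi.add_apply, Pi.mul_apply]; ring
      rw [e]
      exact ((ih (hf v) hg (by omega)).add (ih hf (hg v) (by omega))).add
        (ih (hf v) (hg v).succ (by omega))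

theorem KilledBy.const (c : K) : KilledBy (diffOp K : G → _) 1 (fun _ => c) := by
  intro v; rw [KilledBy]; ext z; simp [diffOp_apply]

theorem KilledBy.pow {f : G → K} (hf : KilledBy (diffOp K) 2 f) (n : ℕ) :
    KilledBy (diffOp K) (n + 1) (f ^ n) := by
  induction n with
  | zero => rw [pow_zero]; exact KilledBy.const 1
  | succ n ih => rw [pow_succ]; exact ih.mul hf

theorem KilledBy.prod {α : Type*} (s : Finset α) (f : α → G → K) (e : α → ℕ)
    (hf : ∀ a ∈ s, KilledBy (diffOp K) (e a + 1) (f a)) :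
    KilledBy (diffOp K) ((∑ a ∈ s, e a) + 1) (∏ a ∈ s, f a) := by
  classical
  induction s using Finset.induction_on with
  | empty => exact KilledBy.const 1
  | insert a s ha ih =>
    rw [Finset.prod_insert ha, Finset.sum_insert ha]
    have := (hf a (Finset.mem_insert_self _ _)).mul
      (ih fun b hb => hf b (Finset.mem_insert_of_mem hb))
    exact this.mono (by omega)

/-- A polynomial function of degree `≤ k` on `ℤ^d` is annihilated by every `k + 1` differences. -/
theorem killedBy_eval {d : ℕ} (p : MvPolynomial (Fin d) K) :
    KilledBy (diffOp K) (p.totalDegree + 1)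
      (fun x : Fin d → ℤ => MvPolynomial.eval (fun i => (x i : K)) p) := by
  have e : (fun x : Fin d → ℤ => MvPolynomial.eval (fun i => (x i : K)) p)
      = ∑ m ∈ p.support, (fun _ : Fin d → ℤ => p.coeff m) *
          ∏ i : Fin d, (fun x : Fin d → ℤ => (x i : K)) ^ m i := by
    ext x
    rw [MvPolynomial.eval_eq']
    simp
  rw [e]
  refine KilledBy.sum _ fun m hm => ?_
  have h1 := (KilledBy.const (G := Fin d → ℤ) (p.coeff m)).mul
    (KilledBy.prod Finset.univ (fun i : Fin d => (fun x : Fin d → ℤ => (x i : K)) ^ m i)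
      (fun i => m i) fun i _ => KilledBy.pow (fun v => ?_) (m i))
  · refine h1.mono ?_
    have := MvPolynomial.le_totalDegree hm
    rw [Finsupp.sum_fintype _ _ (by simp)] at this
    omega
  · have : diffOp K v (fun x : Fin d → ℤ => (x i : K)) = fun _ => (v i : K) := by
      ext z; simp [diffOp_apply]
    rw [this]
    exact KilledBy.const _

/-- The forward difference in the second variable. -/
def stepOp (K G : Type*) [Field K] : Module.End K (G → ℕ → K) where
  toFun f := fun z a => f z (a + 1) - f z a
  map_add' f g := by ext z; simp; ring
  map_smul' c f := by ext z; simp; ring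

/-- The difference operator in the first variable. -/
def shiftOp (K : Type*) [Field K] (v : G) : Module.End K (G → ℕ → K) where
  toFun f := fun z a => f (z + v) a - f z a
  map_add' f g := by ext z; simp; ring
  map_smul' c f := by ext z; simp; ring

theorem stepOp_apply {G : Type*} (f : G → ℕ → K) (z : G) (a : ℕ) :
    stepOp K G f z a = f z (a + 1) - f z a := rfl

theorem shiftOp_apply (v : G) (f : G → ℕ → K) (z : G) (a : ℕ) :
    shiftOp K v f z a = f (z + v) a - f z a := rfl

theorem stepOp_commute (v : G) : Commute (stepOp K G) (shiftOp K v) := by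
  refine LinearMap.ext fun f => funext fun z => funext fun a => ?_
  simp only [Module.End.mul_apply, stepOp_apply, shiftOp_apply]
  ring

theorem shiftOp_commute (v w : G) : Commute (shiftOp K v) (shiftOp K w) := by
  refine LinearMap.ext fun f => funext fun z => funext fun a => ?_
  simp only [Module.End.mul_apply, shiftOp_apply, add_right_comm z v w]
  ring

theorem killedBy_shiftOp {ι : Type*} (v : ι → G) (n : ℕ) (f : G → ℕ → K)
    (h : ∀ a, KilledBy (diffOp K) n fun z => f z a) :
    KilledBy (fun i => shiftOp K (v i)) n f := by
  induction n generalizing f with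
  | zero => exact funext fun z => funext fun a => congrFun (h a) z
  | succ n ih => exact fun i => ih _ fun a => h a (v i)

/-- The product of the operators `(z, a) ↦ (z, a + 1)` minus `(z, a) ↦ (z + v i, a)`, expanded. -/
theorem prod_stepOp_sub_shiftOp_apply {ι : Type*} [DecidableEq ι] (v : ι → G) (f : G → ℕ → K)
    (l : List ι) (hl : l.Nodup) : ∀ z a,
      (l.map fun i => stepOp K G - shiftOp K (v i)).prod f z a =
        ∑ I ∈ l.toFinset.powerset,
          (-1 : ℤ) ^ I.card • f (z + ∑ i ∈ I, v i) (a + (l.length - I.card)) := by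
  induction l with
  | nil => intro z a; simp
  | cons i l ih =>
    intro z a
    obtain ⟨hi, hl⟩ := List.nodup_cons.1 hl
    have hi' : i ∉ l.toFinset := by simpa using hi
    rw [List.map_cons, List.prod_cons, Module.End.mul_apply, LinearMap.sub_apply,
      Pi.sub_apply, Pi.sub_apply, stepOp_apply, shiftOp_apply, sub_sub_sub_cancel_right,
      ih hl, ih hl, List.toFinset_cons, Finset.sum_powerset_insert hi', sub_eq_add_neg,
      ← Finset.sum_neg_distrib]
    congr 1 <;> refine Finset.sum_congr rfl fun I hI => ?_
    · have hc : I.card ≤ l.length :=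
        (Finset.card_le_card (Finset.mem_powerset.1 hI)).trans (List.toFinset_card_le l)
      rw [List.length_cons]
      congr 2
      omega
    · have hiI : i ∉ I := fun h => hi' (Finset.mem_powerset.1 hI h)
      rw [Finset.card_insert_of_notMem hiI, Finset.sum_insert hiI, List.length_cons,
        Nat.add_sub_add_right, pow_succ, mul_neg_one, neg_smul, add_assoc]

/-! ### Recognizing polynomials -/

variable [CharZero K]

open Polynomial in
/-- Newton's interpolation formula. -/
theorem exists_polynomial_of_fwdDiff_iter_eq_zero (g : ℕ → K) (N : ℕ)
    (h : ∀ n, (fwdDiff 1)^[N] g n = 0) :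
    ∃ p : K[X], p.degree < N ∧ ∀ n : ℕ, g n = p.eval (n : K) := by
  refine ⟨∑ k ∈ Finset.range N,
    C ((fwdDiff 1)^[k] g 0 / (k.factorial : K)) * descPochhammer K k, ?_, fun n => ?_⟩
  · rcases Nat.eq_zero_or_pos N with rfl | hN
    · simp
    refine lt_of_le_of_lt (degree_sum_le _ _) ((Finset.sup_lt_iff (by simp)).2 ?_)
    intro k hk
    refine lt_of_le_of_lt (degree_mul_le _ _) ?_
    refine lt_of_le_of_lt (add_le_add degree_C_le degree_le_natDegree) ?_
    rw [descPochhammer_natDegree, zero_add]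
    exact_mod_cast Finset.mem_range.1 hk
  · have h0 : ∀ k, N ≤ k → (fwdDiff 1)^[k] g 0 = 0 := by
      intro k hk
      obtain ⟨j, rfl⟩ := Nat.exists_eq_add_of_le' hk
      have : (fwdDiff 1)^[N] g = fun _ => 0 := funext h
      rw [Function.iterate_add_apply, this]
      have h0 : ∀ j, (fwdDiff 1)^[j] (fun _ => 0 : ℕ → K) = fun _ => 0 := fun j =>
        Function.iterate_fixed (fwdDiff_const 1 0) j
      rw [h0]
    have h1 := shift_eq_sum_fwdDiff_iter 1 g n 0
    simp only [zero_add, smul_eq_mul, mul_one] at h1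
    rw [h1, eval_finsetSum]
    simp only [eval_mul, eval_C, descPochhammer_eval_eq_descFactorial]
    have e : ∀ k, n.choose k • (fwdDiff 1)^[k] g 0
        = (fwdDiff 1)^[k] g 0 / (k.factorial : K) * (n.descFactorial k : K) := by
      intro k
      rw [Nat.descFactorial_eq_factorial_mul_choose, nsmul_eq_mul]
      have := Nat.cast_ne_zero (R := K).2 (Nat.factorial_ne_zero k)
      push_cast
      field_simp
    simp only [← e]
    trans ∑ k ∈ Finset.range (n + 1 + N), n.choose k • (fwdDiff 1)^[k] g 0
    · refine Finset.sum_subset (by intro k; simp; omega) fun k _ hk => ?_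
      rw [Nat.choose_eq_zero_of_lt (by simpa using hk), zero_smul]
    · refine (Finset.sum_subset (by intro k; simp; omega) fun k _ hk => ?_).symm
      rw [h0 k (by simpa using hk), smul_zero]

open Polynomial in
/-- If `G z a` is a polynomial of degree `≤ k` in `z` and satisfies the recursion given by the
product of the `w` operators `(z, a) ↦ (z, a + 1)` minus `(z, a) ↦ (z + v i, a)`, then it is a
polynomial of degree `< w + k` in `a`. -/
theorem exists_polynomial_of_recursion {ι : Type*} [Fintype ι] [DecidableEq ι] {d : ℕ}
    (v : ι → Fin d → ℤ) (k : ℕ) (f : (Fin d → ℤ) → ℕ → K)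
    (hpoly : ∀ a, ∃ p : MvPolynomial (Fin d) K, p.totalDegree ≤ k ∧
      ∀ x : Fin d → ℤ, f x a = MvPolynomial.eval (fun i => (x i : K)) p)
    (hrec : ∀ z a, ∑ I : Finset ι, (-1 : ℤ) ^ I.card •
      f (z + ∑ i ∈ I, v i) (a + (Fintype.card ι - I.card)) = 0) (z : Fin d → ℤ) :
    ∃ p : K[X], p.degree < (Fintype.card ι + k : ℕ) ∧ ∀ a : ℕ, f z a = p.eval (a : K) := by
  refine exists_polynomial_of_fwdDiff_iter_eq_zero _ _ fun a => ?_
  have h1 : KilledBy (fun i => shiftOp K (v i)) (k + 1) f :=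
    killedBy_shiftOp v _ f fun a => by
      obtain ⟨p, hp, hfp⟩ := hpoly a
      rw [funext hfp]
      exact (killedBy_eval p).mono (by omega)
  have h2 := pow_apply_eq_zero (fun i => stepOp_commute (v i))
    (fun i j => shiftOp_commute (v i) (v j)) _ Finset.univ.toList f h1 (by
      ext z a
      rw [prod_stepOp_sub_shiftOp_apply v f _ (Finset.nodup_toList _)]
      simpa using hrec z a)
  have h3 : ∀ n, ((stepOp K (Fin d → ℤ)) ^ n) f z a = (fwdDiff 1)^[n] (f z) a := by
    intro n
    have : ∀ n (f : (Fin d → ℤ) → ℕ → K),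
        ((stepOp K (Fin d → ℤ)) ^ n) f z = (fwdDiff 1)^[n] (f z) := by
      intro n
      induction n with
      | zero => intro f; rfl
      | succ n ih => intro f; rw [pow_succ, Module.End.mul_apply, ih]; rfl
    rw [this]
  rw [← h3]
  rw [Finset.length_toList, Finset.card_univ, Nat.add_sub_assoc (by omega),
    Nat.add_sub_cancel] at h2
  rw [h2]; rfl

/-- A function on `ℕ^n` that is a polynomial of bounded degree in each variable is a polynomial. -/
theorem exists_mvPolynomial_of_separately_polynomial {n : ℕ} (N : Fin n → ℕ)
    (f : (Fin n → ℕ) → K)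
    (h : ∀ i m, ∃ p : Polynomial K, p.degree < N i ∧
      ∀ a : ℕ, f (Function.update m i a) = p.eval (a : K)) :
    ∃ E : MvPolynomial (Fin n) K, ∀ m, f m = MvPolynomial.eval (fun i => (m i : K)) E := by
  induction n with
  | zero =>
    refine ⟨MvPolynomial.C (f 0), fun m => ?_⟩
    rw [MvPolynomial.eval_C, Subsingleton.elim m 0]
  | succ n ih =>
    have ih' : ∀ j : ℕ, ∃ E : MvPolynomial (Fin n) K,
        ∀ m, f (Fin.cons j m) = MvPolynomial.eval (fun i => (m i : K)) E := by
      intro j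
      refine ih (fun i => N i.succ) (fun m => f (Fin.cons j m)) fun i m => ?_
      obtain ⟨p, hp, hfp⟩ := h i.succ (Fin.cons j m)
      refine ⟨p, hp, fun a => ?_⟩
      rw [← hfp, Fin.cons_update]
    choose E hE using ih'
    refine ⟨∑ j ∈ Finset.range (N 0),
      Polynomial.aeval (MvPolynomial.X 0)
        (Lagrange.basis (Finset.range (N 0)) (fun j : ℕ => (j : K)) j) *
        MvPolynomial.rename Fin.succ (E j), fun m => ?_⟩
    obtain ⟨p, hp, hfp⟩ := h 0 m
    have hinj : Set.InjOn (fun j : ℕ => (j : K)) (Finset.range (N 0)) :=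
      fun a _ b _ hab => Nat.cast_injective hab
    have hp' := Lagrange.eq_interpolate hinj (f := p) (by simpa using hp)
    have hm : f m = p.eval (m 0 : K) := by rw [← hfp, Function.update_eq_self]
    rw [hm, hp', Lagrange.interpolate_apply, Polynomial.eval_finsetSum, map_sum]
    refine Finset.sum_congr rfl fun j _ => ?_
    have h1 : p.eval (j : K) = f (Fin.cons j (Fin.tail m)) := by
      rw [← hfp]; congr 1; ext i; refine Fin.cases ?_ (fun i => ?_) i <;> simp [Fin.tail]
    rw [Polynomial.eval_mul, Polynomial.eval_C, h1, hE, map_mul, mul_comm,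
      MvPolynomial.eval_rename]
    congr 1
    have := Polynomial.aeval_algHom_apply (MvPolynomial.aeval (R := K) (fun i => (m i : K)))
      (MvPolynomial.X 0) (Lagrange.basis (Finset.range (N 0)) (fun j : ℕ => (j : K)) j)
    rw [MvPolynomial.aeval_X, Polynomial.coe_aeval_eq_eval, MvPolynomial.aeval_eq_eval] at this
    exact this

/-- The total degree of a polynomial can be read off from its restrictions to the lines through
the origin and a point of `ℕ^σ`. -/
theorem totalDegree_le_of_restrict_line {σ : Type*} (E : MvPolynomial σ K) (D : ℕ)
    (h : ∀ m : σ → ℕ, ∃ p : Polynomial K, p.degree < (D + 1 : ℕ) ∧ ∀ t : ℕ, 0 < t →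
      MvPolynomial.eval (fun i => ((t * m i : ℕ) : K)) E = p.eval (t : K)) :
    E.totalDegree ≤ D := by
  have hz : ∀ j, D < j → MvPolynomial.homogeneousComponent j E = 0 := by
    intro j hj
    refine MvPolynomial.funext_set (fun _ => Set.range ((↑) : ℕ → K))
      (fun _ => Set.infinite_range_of_injective Nat.cast_injective) fun x hx => ?_
    choose m hm using fun i => hx i (Set.mem_univ i)
    obtain rfl : (fun i => (m i : K)) = x := funext hm
    obtain ⟨p, hp, hpE⟩ := h m
    set q : Polynomial K := ∑ j ∈ Finset.range (E.totalDegree + 1),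
      Polynomial.C (MvPolynomial.eval (fun i => (m i : K))
        (MvPolynomial.homogeneousComponent j E)) * Polynomial.X ^ j with hq
    have hqp : q = p := by
      refine Polynomial.eq_of_infinite_eval_eq _ _
        (Set.Infinite.mono (s := ((↑) : ℕ → K) '' Set.Ioi 0) ?_
          ((Set.Ioi_infinite 0).image Nat.cast_injective.injOn))
      rintro _ ⟨t, ht, rfl⟩
      show q.eval (t : K) = p.eval (t : K)
      rw [← hpE t ht]
      conv_rhs => rw [← MvPolynomial.sum_homogeneousComponent E]
      rw [hq, Polynomial.eval_finsetSum, map_sum]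
      refine Finset.sum_congr rfl fun j _ => ?_
      rw [Polynomial.eval_mul, Polynomial.eval_C, Polynomial.eval_pow, Polynomial.eval_X,
        MvPolynomial.eval_eq, MvPolynomial.eval_eq, Finset.sum_mul]
      refine Finset.sum_congr rfl fun e he => ?_
      have hdeg := MvPolynomial.homogeneousComponent_isHomogeneous j E
        (MvPolynomial.mem_support_iff.1 he)
      rw [Finsupp.weight_apply, Finsupp.sum] at hdeg
      simp only [Pi.one_apply, smul_eq_mul, mul_one] at hdeg
      simp only [Nat.cast_mul, mul_pow, Finset.prod_mul_distrib, Finset.prod_pow_eq_pow_sum]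
      rw [hdeg]
      ring
    by_cases hjE : j ≤ E.totalDegree
    · have hc : q.coeff j = 0 := by
        rw [hqp]
        exact Polynomial.coeff_eq_zero_of_degree_lt (hp.trans_le (by exact_mod_cast hj))
      rw [map_zero, ← hc, hq, Polynomial.finsetSum_coeff]
      simp only [Polynomial.coeff_C_mul, Polynomial.coeff_X_pow]
      rw [Finset.sum_eq_single_of_mem j (by simp; omega)]
      · simp
      · intro i _ hij; simp [hij.symm]
    · rw [MvPolynomial.homogeneousComponent_eq_zero _ _ (by omega)]
  refine Finset.sup_le fun e he => ?_
  by_contra hlt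
  push Not at hlt
  have h0 := congrArg (MvPolynomial.coeff e) (hz _ hlt)
  rw [MvPolynomial.coeff_homogeneousComponent, if_pos (by simp [Finsupp.degree_apply, Finsupp.sum]),
    MvPolynomial.coeff_zero] at h0
  exact MvPolynomial.mem_support_iff.1 he h0

end Differences

/-! ### Integer polytopes -/

section Hull

variable {F : Type*} [NormedAddCommGroup F] [NormedSpace ℝ F] {ι : Type*} [Fintype ι]

theorem mem_smul_convexHull_range [Nonempty ι] (v : ι → F) {s : ℝ} (hs : 0 ≤ s) (x : F) :
    x ∈ s • convexHull ℝ (Set.range v) ↔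
      ∃ a : ι → ℝ, (∀ i, 0 ≤ a i) ∧ ∑ i, a i = s ∧ ∑ i, a i • v i = x := by
  constructor
  · rintro ⟨y, hy, rfl⟩
    rw [convexHull_range_eq_exists_affineCombination] at hy
    obtain ⟨t, w, hw, hw1, rfl⟩ := hy
    classical
    refine ⟨fun i => s * if i ∈ t then w i else 0, fun i => ?_, ?_, ?_⟩
    · dsimp only
      split_ifs with h
      · exact mul_nonneg hs (hw i h)
      · simp
    · rw [← Finset.mul_sum, Finset.sum_ite_mem, Finset.univ_inter, hw1, mul_one]
    · rw [Finset.affineCombination_eq_linear_combination _ _ _ hw1]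
      simp only [Finset.smul_sum, mul_smul, ite_smul, zero_smul]
      rw [← Finset.smul_sum, Finset.sum_ite_mem, Finset.univ_inter, Finset.smul_sum]
  · rintro ⟨a, ha, hsum, rfl⟩
    rcases hs.eq_or_lt with rfl | hs
    · have h0 : ∀ i, a i = 0 := fun i =>
        (Finset.sum_eq_zero_iff_of_nonneg fun i _ => ha i).1 hsum i (Finset.mem_univ i)
      rw [Set.zero_smul_set (Set.range_nonempty v).convexHull]
      simp [h0]
    · refine ⟨∑ i, (s⁻¹ * a i) • v i, ?_, ?_⟩
      · refine mem_convexHull_of_exists_fintype (fun i => s⁻¹ * a i) v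
          (fun i => mul_nonneg (inv_nonneg.2 hs.le) (ha i)) ?_ (fun i => Set.mem_range_self i) rfl
        rw [← Finset.mul_sum, hsum, inv_mul_cancel₀ hs.ne']
      · simp only [Finset.smul_sum, smul_smul]
        refine Finset.sum_congr rfl fun i _ => ?_
        rw [mul_inv_cancel_left₀ hs.ne']

/-- The linear map `a ↦ ∑ a i • v i`. -/
noncomputable def combination (v : ι → F) : (ι → ℝ) →L[ℝ] F :=
  ∑ i, (ContinuousLinearMap.proj (R := ℝ) (φ := fun _ : ι => ℝ) i).smulRight (v i)

theorem combination_apply (v : ι → F) (a : ι → ℝ) : combination v a = ∑ i, a i • v i := by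
  simp [combination]

/-- The points of the standard simplex dilated by `r` whose coordinates in `I` are at least `1`: a
translate of the simplex dilated by `r - #I` if `#I ≤ r`. -/
def cutSimplex (r : ℕ) (I : Finset ι) : Set (ι → ℝ) :=
  Set.Icc ((I : Set ι).indicator 1) (fun _ => (r : ℝ)) ∩ {a | ∑ i, a i = r}

theorem convex_sum_eq (r : ℝ) : Convex ℝ {a : ι → ℝ | ∑ i, a i = r} :=
  convex_hyperplane (f := fun a : ι → ℝ => ∑ i, a i)
    ⟨fun a b => by simp [Finset.sum_add_distrib], fun c a => by simp [Finset.mul_sum]⟩ r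

theorem isClosed_sum_eq (r : ℝ) : IsClosed {a : ι → ℝ | ∑ i, a i = r} :=
  isClosed_eq (by fun_prop) continuous_const

theorem mem_cutSimplex {r : ℕ} {I : Finset ι} {a : ι → ℝ} :
    a ∈ cutSimplex r I ↔ (∀ i, 0 ≤ a i) ∧ (∀ i ∈ I, 1 ≤ a i) ∧ ∑ i, a i = r := by
  classical
  constructor
  · rintro ⟨⟨h1, -⟩, h3⟩
    refine ⟨fun i => le_trans ?_ (h1 i), fun i hi => ?_, h3⟩
    · by_cases hi : i ∈ I <;> simp [hi]
    · have := h1 i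
      simpa [Set.indicator_apply, hi] using this
  · rintro ⟨h0, h1, h3⟩
    refine ⟨⟨fun i => ?_, fun i => ?_⟩, h3⟩
    · by_cases hi : i ∈ I
      · simpa [Set.indicator_apply, hi] using h1 i hi
      · simpa [Set.indicator_apply, hi] using h0 i
    · rw [← show ∑ i, a i = r from h3]
      exact Finset.single_le_sum (fun i _ => h0 i) (Finset.mem_univ i)

variable [DecidableEq ι]

/-- The recursion for dilates of a polytope: a multiple `r • P` with `r ≥ #ι` is covered by the
translates `v i + (r - 1) • P`, and inclusion-exclusion works as if they intersected in the sets
`∑ i ∈ I, v i + (r - #I) • P`. This holds literally for a simplex, and is transported to `P` by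
pushing forward along a linear map. -/
theorem dilate_recursion [Nonempty ι] [FiniteDimensional ℝ F] (v : ι → F) (Q : Set F)
    (hQ : IsCompact Q) (hQ' : Convex ℝ Q) (r : ℕ) (hr : Fintype.card ι ≤ r) (y : F) :
    ∑ I : Finset ι, ({∑ i ∈ I, v i} + ((r - I.card : ℕ) : ℝ) • convexHull ℝ (Set.range v) +
      Q).indicator (fun _ => (-1 : ℤ) ^ I.card) y = 0 := by
  have key := image_relation (Finset.univ : Finset (Finset ι)) (fun I => (-1 : ℤ) ^ I.card)
    (fun I => cutSimplex r I ×ˢ Q)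
    (fun I _ => (isCompact_Icc.inter_right (isClosed_sum_eq _)).prod hQ)
    (fun I _ => ((convex_Icc _ _).inter (convex_sum_eq _)).prod hQ')
    (by
      rintro ⟨a, q⟩
      by_cases h : q ∈ Q ∧ (∀ i, 0 ≤ a i) ∧ ∑ i, a i = r
      · obtain ⟨hq, h0, hs⟩ := h
        have hne : (Finset.univ.filter fun i => 1 ≤ a i).Nonempty := by
          by_contra hcon
          rw [Finset.not_nonempty_iff_eq_empty, Finset.filter_eq_empty_iff] at hcon
          have : ∑ i, a i < ∑ _i : ι, (1 : ℝ) :=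
            Finset.sum_lt_sum_of_nonempty Finset.univ_nonempty
              fun i hi => not_le.1 (hcon hi)
          rw [hs] at this
          simp only [Finset.sum_const, Finset.card_univ, nsmul_eq_mul, mul_one] at this
          exact absurd (Nat.cast_lt.1 this) (not_lt.2 hr)
        rw [← Finset.sum_powerset_neg_one_pow_card_of_nonempty hne]
        classical
        simp only [Set.indicator_apply]
        rw [← Finset.sum_filter]
        refine Finset.sum_congr ?_ fun _ _ => rfl
        ext I
        simp only [Finset.mem_filter, Finset.mem_univ, true_and, Set.mem_prod, mem_cutSimplex,
          Finset.mem_powerset, Finset.subset_iff]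
        tauto
      · refine Finset.sum_eq_zero fun I _ => Set.indicator_of_notMem (fun hm => h ?_) _
        obtain ⟨h1, h2⟩ := hm
        obtain ⟨h3, -, h4⟩ := mem_cutSimplex.1 h1
        exact ⟨h2, h3, h4⟩)
    ((combination v).coprod (ContinuousLinearMap.id ℝ F)) y
  rw [← key]
  refine Finset.sum_congr rfl fun I _ => ?_
  congr 1
  have hIr : I.card ≤ r := (Finset.card_le_univ I).trans hr
  have hInd : ∑ i, (I : Set ι).indicator (1 : ι → ℝ) i = I.card := by
    simp [Set.indicator_apply]
  have hIv : ∑ i, (I : Set ι).indicator (1 : ι → ℝ) i • v i = ∑ i ∈ I, v i := by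
    simp [Set.indicator_apply]
  ext x
  simp only [Set.mem_add, Set.mem_singleton_iff, Set.mem_image, Set.mem_prod, Prod.exists,
    ContinuousLinearMap.coprod_apply, combination_apply, ContinuousLinearMap.id_apply]
  constructor
  · rintro ⟨_, ⟨_, rfl, z, hz, rfl⟩, q, hq, rfl⟩
    obtain ⟨b, hb, hbs, rfl⟩ := (mem_smul_convexHull_range v (Nat.cast_nonneg _) z).1 hz
    refine ⟨b + (I : Set ι).indicator 1, q, ⟨mem_cutSimplex.2 ⟨fun i => ?_, fun i hi => ?_, ?_⟩,
      hq⟩, ?_⟩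
    · exact add_nonneg (hb i) (Set.indicator_nonneg (fun _ _ => zero_le_one) i)
    · simpa [hi] using hb i
    · simp only [Pi.add_apply, Finset.sum_add_distrib, hInd, hbs, Nat.cast_sub hIr]
      ring
    · simp only [Pi.add_apply, add_smul, Finset.sum_add_distrib, hIv]
      abel
  · rintro ⟨a, q, ⟨ha, hq⟩, rfl⟩
    obtain ⟨h0, h1, hs⟩ := mem_cutSimplex.1 ha
    refine ⟨∑ i ∈ I, v i + (∑ i, (a i - (I : Set ι).indicator 1 i) • v i), ⟨_, rfl, _,
      (mem_smul_convexHull_range v (Nat.cast_nonneg _) _).2 ⟨_, fun i => ?_, ?_, rfl⟩, rfl⟩,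
      q, hq, ?_⟩
    · by_cases hi : i ∈ I
      · simpa [hi] using h1 i hi
      · simpa [hi] using h0 i
    · rw [Finset.sum_sub_distrib, hInd, hs, Nat.cast_sub hIr]
    · simp only [sub_smul, Finset.sum_sub_distrib, hIv]
      abel

/-- The face of the standard simplex on which the coordinates in `I` vanish. -/
def simplexFace (I : Finset ι) : Set (ι → ℝ) :=
  Set.Icc 0 (((I : Set ι)ᶜ).indicator 1) ∩ {a | ∑ i, a i = 1}

theorem mem_simplexFace {I : Finset ι} {a : ι → ℝ} :
    a ∈ simplexFace I ↔ (∀ i, 0 ≤ a i) ∧ (∀ i ∈ I, a i = 0) ∧ ∑ i, a i = 1 := by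
  constructor
  · rintro ⟨⟨h1, h2⟩, h3⟩
    refine ⟨h1, fun i hi => le_antisymm ?_ (h1 i), h3⟩
    have := h2 i
    simpa [Set.indicator_apply, hi] using this
  · rintro ⟨h0, h1, h3⟩
    refine ⟨⟨h0, fun i => ?_⟩, h3⟩
    by_cases hi : i ∈ I
    · simpa [Set.indicator_apply, hi] using (h1 i hi).le
    · rw [Set.indicator_of_mem (by simpa using hi), Pi.one_apply,
        ← show ∑ i, a i = 1 from h3]
      exact Finset.single_le_sum (fun i _ => h0 i) (Finset.mem_univ i)

theorem combination_image_simplexFace (v : ι → F) (I : Finset ι) :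
    combination v '' simplexFace I = convexHull ℝ (v '' (I : Set ι)ᶜ) := by
  ext x
  constructor
  · rintro ⟨a, ha, rfl⟩
    obtain ⟨h0, h1, hs⟩ := mem_simplexFace.1 ha
    rw [combination_apply, ← Finset.sum_filter_of_ne (p := fun i => i ∉ I)
      (fun i _ hi hiI => hi (by rw [h1 i hiI, zero_smul]))]
    refine (convex_convexHull ℝ _).sum_mem (fun i _ => h0 i) ?_ fun i hi => ?_
    · rw [← hs]
      exact Finset.sum_filter_of_ne (fun i _ hi hiI => hi (h1 i hiI))
    · exact subset_convexHull ℝ _ ⟨i, by simpa using hi, rfl⟩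
  · refine fun hx => convexHull_min ?_ ?_ hx
    · rintro _ ⟨i, hi, rfl⟩
      refine ⟨Pi.single i 1, mem_simplexFace.2 ⟨fun j => ?_, fun j hj => ?_, by simp⟩, ?_⟩
      · by_cases h : j = i
        · subst h; simp
        · simp [h]
      · have : j ≠ i := fun h => hi (by simpa [h] using hj)
        simp [this]
      · simp [combination_apply, Pi.single_apply]
    · exact ((convex_Icc _ _).inter (convex_sum_eq _)).linear_image (combination v).toLinearMap

/-- A relation between the polytopes spanned by subsets of an affinely dependent family. The
standard simplex projected along the dependency `c` is covered by the projections of the facets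
at which the points moving in direction `-c` leave the simplex. -/
theorem convexHull_relation [FiniteDimensional ℝ F] (v : ι → F) (c : ι → ℝ) (hc : ∑ i, c i = 0)
    (hcv : ∑ i, c i • v i = 0) (hpos : ∃ i, 0 < c i) (y : F) :
    ∑ I ∈ (Finset.univ.filter fun i => 0 < c i).powerset,
      (convexHull ℝ (v '' (I : Set ι)ᶜ)).indicator (fun _ => (-1 : ℤ) ^ I.card) y = 0 := by
  obtain ⟨i₀, hi₀⟩ := hpos
  set A := Finset.univ.filter fun i => 0 < c i with hA
  -- the projection along `c` to the hyperplane on which the coordinate `i₀` vanishes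
  set ρ : (ι → ℝ) →L[ℝ] (ι → ℝ) := ContinuousLinearMap.id ℝ _ -
    ((c i₀)⁻¹ • ContinuousLinearMap.proj (R := ℝ) (φ := fun _ : ι => ℝ) i₀).smulRight c with hρ
  have hρa : ∀ a, ρ a = a - ((c i₀)⁻¹ * a i₀) • c := fun a => by simp [hρ]
  have hcomb : ∀ a, combination v (ρ a) = combination v a := by
    intro a
    rw [hρa, map_sub, map_smul, combination_apply v c, hcv, smul_zero, sub_zero]
  have key := image_relation A.powerset (fun I => (-1 : ℤ) ^ I.card)
    (fun I => ρ '' simplexFace I)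
    (fun I _ => (isCompact_Icc.inter_right (isClosed_sum_eq _)).image ρ.continuous)
    (fun I _ => ((convex_Icc _ _).inter (convex_sum_eq _)).linear_image ρ.toLinearMap)
    (by
      intro z
      by_cases hz : z ∈ ρ '' simplexFace (∅ : Finset ι)
      · obtain ⟨a, ha, rfl⟩ := hz
        obtain ⟨h0, -, hs⟩ := mem_simplexFace.1 ha
        obtain ⟨j, hj, hmin⟩ := A.exists_min_image (fun i => a i / c i)
          ⟨i₀, by simpa [hA] using hi₀⟩
        have hcj : 0 < c j := by simpa [hA] using hj
        -- the point at which the line through `a` in direction `-c` leaves the simplex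
        set b : ι → ℝ := a - (a j / c j) • c with hb
        have hbj : b j = 0 := by simp [hb, hcj.ne']
        have hb0 : ∀ i, 0 ≤ b i := by
          intro i
          simp only [hb, Pi.sub_apply, Pi.smul_apply, smul_eq_mul, sub_nonneg]
          rcases lt_or_ge 0 (c i) with hi | hi
          · exact (le_div_iff₀ hi).1 (hmin i (by simpa [hA] using hi))
          · exact (mul_nonpos_of_nonneg_of_nonpos (div_nonneg (h0 j) hcj.le) hi).trans (h0 i)
        have hbs : ∑ i, b i = 1 := by
          simp [hb, Finset.sum_sub_distrib, ← Finset.mul_sum, hc, hs]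
        have hρc : ρ c = 0 := by
          rw [hρa, inv_mul_cancel₀ hi₀.ne', one_smul, sub_self]
        have hρb : ρ b = ρ a := by
          rw [hb, map_sub, map_smul, hρc, smul_zero, sub_zero]
        have hmem : ∀ I ∈ A.powerset, (ρ a ∈ ρ '' simplexFace I ↔ ∀ i ∈ I, b i = 0) := by
          intro I hI
          constructor
          · rintro ⟨e, he, hea⟩ i hi
            obtain ⟨he0, heI, -⟩ := mem_simplexFace.1 he
            rw [← hρb] at hea
            -- `e = b + s • c`, where `s ≥ 0` by the coordinate `j`, and `s ≤ 0` by `i`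
            obtain ⟨s, hs⟩ : ∃ s : ℝ, ∀ l, e l = b l + s * c l := by
              refine ⟨(c i₀)⁻¹ * (e i₀ - b i₀), fun l => ?_⟩
              have := congrFun hea l
              simp only [hρa, Pi.sub_apply, Pi.smul_apply, smul_eq_mul] at this
              linear_combination this
            have hs0 : 0 ≤ s := by
              have := he0 j
              rw [hs, hbj, zero_add] at this
              exact nonneg_of_mul_nonneg_left this hcj
            have hci : 0 < c i := by
              have := Finset.mem_powerset.1 hI hi
              simpa [hA] using this
            have := hs i
            rw [heI i hi] at this
            nlinarith [hb0 i, mul_nonneg hs0 hci.le]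
          · exact fun h => ⟨b, mem_simplexFace.2 ⟨hb0, h, hbs⟩, hρb⟩
        have hne : (A.filter fun i => b i = 0).Nonempty := ⟨j, Finset.mem_filter.2 ⟨hj, hbj⟩⟩
        rw [← Finset.sum_powerset_neg_one_pow_card_of_nonempty hne]
        classical
        simp only [Set.indicator_apply]
        rw [← Finset.sum_filter]
        refine Finset.sum_congr ?_ fun _ _ => rfl
        ext I
        rw [Finset.mem_filter]
        constructor
        · rintro ⟨hI, h⟩
          rw [Finset.mem_powerset] at hI ⊢
          exact fun i hi => Finset.mem_filter.2
            ⟨hI hi, (hmem I (Finset.mem_powerset.2 hI)).1 h i hi⟩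
        · intro hI
          rw [Finset.mem_powerset] at hI
          have hIA : I ∈ A.powerset :=
            Finset.mem_powerset.2 (hI.trans (Finset.filter_subset _ _))
          exact ⟨hIA, (hmem I hIA).2 fun i hi => (Finset.mem_filter.1 (hI hi)).2⟩
      · refine Finset.sum_eq_zero fun I _ => Set.indicator_of_notMem (fun hm => hz ?_) _
        refine Set.image_mono (fun e he => ?_) hm
        obtain ⟨h1, -, h2⟩ := mem_simplexFace.1 he
        exact mem_simplexFace.2 ⟨h1, by simp, h2⟩)
    (combination v) y
  rw [← key]
  refine Finset.sum_congr rfl fun I _ => ?_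
  rw [← combination_image_simplexFace, Set.image_image]
  simp only [hcomb]

end Hull

/-! ### Polynomiality on Minkowski sums of integer polytopes -/

section IntegerPolytopes

variable {d : ℕ}

@[simp] theorem latticePoint_zero : latticePoint (0 : Fin d → ℤ) = 0 := by
  ext; simp [latticePoint]

theorem latticePoint_add (x y : Fin d → ℤ) :
    latticePoint (x + y) = latticePoint x + latticePoint y := by
  ext; simp [latticePoint]

theorem latticePoint_nsmul (n : ℕ) (x : Fin d → ℤ) :
    latticePoint (n • x) = (n : ℝ) • latticePoint x := by
  ext; simp [latticePoint]

theorem latticePoint_sum {ι : Type*} (s : Finset ι) (v : ι → Fin d → ℤ) :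
    latticePoint (∑ i ∈ s, v i) = ∑ i ∈ s, latticePoint (v i) := by
  ext; simp [latticePoint]

theorem latticePoint_injective : Function.Injective (latticePoint (d := d)) := by
  intro x y h
  ext i
  have := congrFun h i
  simpa [latticePoint] using this

theorem isIntegerPolytope_of_finite {V : Set (Fin d → ℤ)} (hV : V.Finite) :
    IsIntegerPolytope (convexHull ℝ (latticePoint '' V)) :=
  ⟨hV.toFinset, by rw [hV.coe_toFinset]⟩

theorem isIntegerPolytope_singleton (x : Fin d → ℤ) :
    IsIntegerPolytope ({latticePoint x} : Set (Fin d → ℝ)) := by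
  have := isIntegerPolytope_of_finite (Set.finite_singleton x)
  rwa [Set.image_singleton, convexHull_singleton] at this

namespace IsIntegerPolytope

variable {P Q : Set (Fin d → ℝ)}

theorem isCompact (hP : IsIntegerPolytope P) : IsCompact P := by
  obtain ⟨S, rfl⟩ := hP
  exact (S.finite_toSet.image _).isCompact_convexHull ℝ

theorem convex (hP : IsIntegerPolytope P) : Convex ℝ P := by
  obtain ⟨S, rfl⟩ := hP
  exact convex_convexHull ℝ _

theorem mem_ring (hP : IsIntegerPolytope P) : P ∈ integerPolytopeRing d :=
  fun _ _ h => h P hP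

theorem add (hP : IsIntegerPolytope P) (hQ : IsIntegerPolytope Q) : IsIntegerPolytope (P + Q) := by
  obtain ⟨S, rfl⟩ := hP
  obtain ⟨T, rfl⟩ := hQ
  have := isIntegerPolytope_of_finite (S.finite_toSet.add T.finite_toSet)
  rwa [← Set.image2_add, Set.image_image2_distrib latticePoint_add, Set.image2_add,
    convexHull_add] at this

theorem nsmul (hP : IsIntegerPolytope P) (n : ℕ) : IsIntegerPolytope ((n : ℝ) • P) := by
  obtain ⟨S, rfl⟩ := hP
  have := isIntegerPolytope_of_finite (S.finite_toSet.image fun x => n • x)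
  rw [Set.image_image] at this
  simp only [latticePoint_nsmul] at this
  rw [← convexHull_smul]
  rwa [← Set.image_smul, Set.image_image]

theorem sum {ι : Type*} (s : Finset ι) (Q : ι → Set (Fin d → ℝ))
    (hQ : ∀ i ∈ s, IsIntegerPolytope (Q i)) : IsIntegerPolytope (∑ i ∈ s, Q i) := by
  classical
  induction s using Finset.induction_on with
  | empty =>
    have := isIntegerPolytope_singleton (0 : Fin d → ℤ)
    rwa [latticePoint_zero] at this
  | insert i s hi ih =>
    rw [Finset.sum_insert hi]
    exact (hQ i (Finset.mem_insert_self _ _)).add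
      (ih fun j hj => hQ j (Finset.mem_insert_of_mem hj))

end IsIntegerPolytope

variable {K : Type*} [Field K] [CharZero K] {k : ℕ} {μ : IntegerValuation d K}

/-- Along dilates of a polytope spanned by `w` lattice points, a polynomial valuation of degree
`≤ k` is a polynomial of degree `< w + k`. -/
theorem exists_polynomial_dilate_add (hμ : μ.IsPolynomial k) {ι : Type*} [Fintype ι] [Nonempty ι]
    (v : ι → Fin d → ℤ) {Q : Set (Fin d → ℝ)} (hQ : IsIntegerPolytope Q) :
    ∃ p : Polynomial K, p.degree < (Fintype.card ι + k : ℕ) ∧ ∀ a : ℕ,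
      μ ((a : ℝ) • convexHull ℝ (Set.range fun i => latticePoint (v i)) + Q) =
        p.eval (a : K) := by
  classical
  set P := convexHull ℝ (Set.range fun i => latticePoint (v i)) with hP
  have hPint : IsIntegerPolytope P := by
    have := isIntegerPolytope_of_finite (Set.finite_range v)
    rwa [← Set.range_comp] at this
  have hPa : ∀ a : ℕ, IsIntegerPolytope ((a : ℝ) • P + Q) := fun a => (hPint.nsmul a).add hQ
  obtain ⟨p, hp, h⟩ := exists_polynomial_of_recursion v k
    (fun z a => μ ((a : ℝ) • P + Q + {latticePoint z})) (fun a => hμ _ (hPa a)) (by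
      intro z a
      have hQz := hQ.add (isIntegerPolytope_singleton z)
      have := addContent_relation (isSetRing_integerPolytopeRing d) μ Finset.univ
        (fun I : Finset ι => {∑ i ∈ I, latticePoint (v i)} +
          ((a + Fintype.card ι - I.card : ℕ) : ℝ) • P + (Q + {latticePoint z}))
        (fun I _ => by
          rw [← latticePoint_sum]
          exact (((isIntegerPolytope_singleton _).add (hPint.nsmul _)).add hQz).mem_ring)
        (fun I => (-1 : ℤ) ^ I.card)
        (dilate_recursion (fun i => latticePoint (v i)) _ hQz.isCompact hQz.convex
          (a + Fintype.card ι) (by omega))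
      rw [← this]
      refine Finset.sum_congr rfl fun I _ => ?_
      rw [← Nat.add_sub_assoc (Finset.card_le_univ I), latticePoint_add, latticePoint_sum,
        ← Set.singleton_add_singleton]
      congr 2
      abel) 0
  refine ⟨p, hp, fun a => ?_⟩
  rw [← h]
  simp

/-- Along dilates of an integer polytope in `ℝ^d`, a polynomial valuation of degree `≤ k` is a
polynomial of degree `≤ d + k`: affine dependencies reduce to polytopes spanned by at most `d + 1`
points. -/
theorem exists_polynomial_dilate (hμ : μ.IsPolynomial k) (S : Finset (Fin d → ℤ)) :
    ∃ p : Polynomial K, p.degree < (k + d + 1 : ℕ) ∧ ∀ a : ℕ, 0 < a →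
      μ ((a : ℝ) • convexHull ℝ (latticePoint '' (S : Set (Fin d → ℤ)))) = p.eval (a : K) := by
  classical
  induction S using Finset.strongInduction with
  | H S ih =>
  have hrange : latticePoint '' (S : Set (Fin d → ℤ)) =
      Set.range fun i : S => latticePoint (i : Fin d → ℤ) := by
    ext; simp
  rcases S.eq_empty_or_nonempty with rfl | hne
  · exact ⟨0, by simp, by simp⟩
  rcases le_or_gt S.card (d + 1) with hS | hS
  · have : Nonempty S := hne.to_subtype
    obtain ⟨p, hp, h⟩ := exists_polynomial_dilate_add hμ (fun i : S => (i : Fin d → ℤ))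
      (isIntegerPolytope_singleton 0)
    refine ⟨p, hp.trans_le ?_, fun a _ => ?_⟩
    · rw [Fintype.card_coe]
      exact_mod_cast (by omega)
    · rw [← h, hrange, latticePoint_zero, Set.singleton_zero, add_zero]
  · obtain ⟨c, hcv, hc, x, hx, hcx⟩ :=
      Module.exists_nontrivial_relation_sum_zero_of_finrank_succ_lt_card (R := ℝ)
        (t := S.image latticePoint) (by
          rw [Finset.card_image_of_injective _ latticePoint_injective]
          simpa using hS)
    rw [Finset.sum_image latticePoint_injective.injOn] at hcv hc
    obtain ⟨x, hxS, rfl⟩ := Finset.mem_image.1 hx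
    obtain ⟨x₀, hx₀, hpos⟩ := Finset.exists_pos_of_sum_zero_of_exists_nonzero _ hc ⟨x, hxS, hcx⟩
    set A := Finset.univ.filter fun i : S => 0 < c (latticePoint (i : Fin d → ℤ)) with hA
    have hrel := convexHull_relation (fun i : S => latticePoint (i : Fin d → ℤ))
      (fun i : S => c (latticePoint (i : Fin d → ℤ)))
      (by rw [← hc, ← Finset.sum_coe_sort S])
      (by rw [← hcv, ← Finset.sum_coe_sort S]) ⟨⟨x₀, hx₀⟩, hpos⟩
    have himg : ∀ I : Finset S, (fun i : S => latticePoint (i : Fin d → ℤ)) '' (I : Set S)ᶜ =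
        latticePoint '' ((S \ I.map (Function.Embedding.subtype _) : Finset (Fin d → ℤ)) :
          Set (Fin d → ℤ)) := by
      intro I
      ext y
      simp only [Set.mem_image, Set.mem_compl_iff, Finset.mem_coe, Finset.mem_sdiff,
        Finset.mem_map, Function.Embedding.subtype_apply, Subtype.exists]
      constructor
      · rintro ⟨a, ha, h1, rfl⟩
        exact ⟨a, ⟨ha, fun ⟨b, hb, h2, h3⟩ => h1 (by subst h3; exact h2)⟩, rfl⟩
      · rintro ⟨a, ⟨ha, h1⟩, rfl⟩
        exact ⟨a, ha, fun h => h1 ⟨a, ha, h, rfl⟩, rfl⟩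
    have hsub : ∀ I ∈ A.powerset.erase ∅, ∃ p : Polynomial K, p.degree < (k + d + 1 : ℕ) ∧
        ∀ a : ℕ, 0 < a → μ ((a : ℝ) • convexHull ℝ
          ((fun i : S => latticePoint (i : Fin d → ℤ)) '' (I : Set S)ᶜ)) = p.eval (a : K) := by
      intro I hI
      obtain ⟨i, hi⟩ := Finset.nonempty_iff_ne_empty.2 (Finset.ne_of_mem_erase hI)
      rw [himg]
      refine ih _ (Finset.sdiff_ssubset ?_ ⟨i, ?_⟩)
      · intro y hy
        obtain ⟨j, -, rfl⟩ := Finset.mem_map.1 hy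
        exact j.2
      · exact Finset.mem_map_of_mem _ hi
    choose! p hp hpμ using hsub
    refine ⟨-∑ I ∈ A.powerset.erase ∅, (-1 : ℤ) ^ I.card • p I, ?_, fun a ha => ?_⟩
    · rw [Polynomial.degree_neg]
      refine lt_of_le_of_lt (Polynomial.degree_sum_le _ _)
        ((Finset.sup_lt_iff (WithBot.bot_lt_coe _)).2 fun I hI => ?_)
      refine lt_of_le_of_lt ?_ (hp I hI)
      rcases neg_one_pow_eq_or ℤ I.card with h | h <;> simp [h]
    · have ha' : (a : ℝ) ≠ 0 := by exact_mod_cast ha.ne'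
      have := addContent_relation (isSetRing_integerPolytopeRing d) μ A.powerset
        (fun I => (a : ℝ) • convexHull ℝ
          ((fun i : S => latticePoint (i : Fin d → ℤ)) '' (I : Set S)ᶜ))
        (fun I _ => by
          rw [himg]
          exact ((isIntegerPolytope_of_finite (Finset.finite_toSet _)).nsmul a).mem_ring)
        (fun I => (-1 : ℤ) ^ I.card) (by
          intro y
          rw [← hrel ((a : ℝ)⁻¹ • y)]
          refine Finset.sum_congr rfl fun I _ => ?_
          simp only [Set.indicator_apply, Set.mem_smul_set_iff_inv_smul_mem₀ ha'])
      rw [← Finset.add_sum_erase _ _ (Finset.empty_mem_powerset A)] at this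
      simp only [Finset.card_empty, pow_zero, one_smul, Finset.coe_empty, Set.compl_empty,
        Set.image_univ] at this
      rw [hrange, eq_neg_of_add_eq_zero_left this, Polynomial.eval_neg,
        Polynomial.eval_finsetSum]
      congr 1
      refine Finset.sum_congr rfl fun I hI => ?_
      rw [hpμ I hI a ha, Polynomial.eval_smul]

/-- A polynomial valuation of degree `≤ k` is a polynomial of degree `≤ k + d` on Minkowski
combinations of nonempty integer polytopes. -/
theorem exists_mvPolynomial_minkowski (hμ : μ.IsPolynomial k) {n : ℕ}
    (Q : Fin n → Set (Fin d → ℝ)) (hQ : ∀ i, IsIntegerPolytope (Q i))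
    (hne : ∀ i, (Q i).Nonempty) :
    ∃ E : MvPolynomial (Fin n) K, E.totalDegree ≤ k + d ∧ ∀ m : Fin n → ℕ,
      μ (∑ i, (m i : ℝ) • Q i) = MvPolynomial.eval (fun i => (m i : K)) E := by
  classical
  choose S hS using hQ
  have hQ : ∀ i, IsIntegerPolytope (Q i) := fun i => ⟨S i, hS i⟩
  obtain ⟨E, hE⟩ := exists_mvPolynomial_of_separately_polynomial (fun i => (S i).card + k)
    (fun m => μ (∑ i, (m i : ℝ) • Q i)) (by
      intro i m
      have hrange : latticePoint '' (S i : Set (Fin d → ℤ)) =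
          Set.range fun j : S i => latticePoint (j : Fin d → ℤ) := by
        ext; simp
      have hnei : Nonempty (S i) := by
        have := hne i
        rw [hS i, convexHull_nonempty_iff, Set.image_nonempty] at this
        exact this.to_subtype
      obtain ⟨p, hp, h⟩ := exists_polynomial_dilate_add hμ
        (fun j : S i => (j : Fin d → ℤ)) (IsIntegerPolytope.sum (Finset.univ.erase i)
          (fun j => (m j : ℝ) • Q j) fun j _ => (hQ j).nsmul _)
      refine ⟨p, by simpa using hp, fun a => ?_⟩
      rw [← h, ← hrange, ← hS i, ← Finset.add_sum_erase _ _ (Finset.mem_univ i),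
        Function.update_self]
      congr 2
      refine Finset.sum_congr rfl fun j hj => ?_
      rw [Function.update_of_ne (Finset.ne_of_mem_erase hj)])
  refine ⟨E, totalDegree_le_of_restrict_line E _ fun m => ?_, hE⟩
  obtain ⟨T, hT⟩ := IsIntegerPolytope.sum Finset.univ (fun i => (m i : ℝ) • Q i)
    fun i _ => (hQ i).nsmul _
  obtain ⟨p, hp, h⟩ := exists_polynomial_dilate hμ T
  refine ⟨p, hp, fun t ht => ?_⟩
  rw [← h t ht, ← hT, ← hE, Finset.smul_sum]
  simp only [smul_smul, Nat.cast_mul]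

end IntegerPolytopes

/-! ### Cobounded convex subsets of a cone -/

section Cobounded

variable {d : ℕ} {C : PointedCone ℝ (Fin d → ℝ)}

theorem convex_coe_pointedCone (C : PointedCone ℝ (Fin d → ℝ)) :
    Convex ℝ (C : Set (Fin d → ℝ)) := fun _ hx _ hy _ _ ha hb _ =>
  C.add_mem (C.smul_mem ha hx) (C.smul_mem hb hy)

theorem coe_add_coe_pointedCone (C : PointedCone ℝ (Fin d → ℝ)) :
    (C : Set (Fin d → ℝ)) + C = C := by
  refine Set.Subset.antisymm ?_ fun x hx => ⟨x, hx, 0, C.zero_mem, add_zero x⟩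
  rintro _ ⟨x, hx, y, hy, rfl⟩
  exact C.add_mem hx hy

theorem smul_coe_pointedCone (C : PointedCone ℝ (Fin d → ℝ)) {c : ℝ} (hc : 0 < c) :
    c • (C : Set (Fin d → ℝ)) = C := by
  ext x
  rw [Set.mem_smul_set_iff_inv_smul_mem₀ hc.ne']
  refine ⟨fun h => ?_, fun h => C.smul_mem (inv_nonneg.2 hc.le) h⟩
  have := C.smul_mem hc.le h
  rwa [smul_inv_smul₀ hc.ne'] at this

namespace IsCobounded

variable {Δ Δ' : Set (Fin d → ℝ)}

theorem exists_mem_of_norm_lt (hΔ : IsCobounded C Δ) : ∃ B : ℝ, ∀ x ∈ C, B < ‖x‖ → x ∈ Δ := by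
  obtain ⟨B, hB⟩ := hΔ.isBounded_compl.exists_norm_le
  refine ⟨B, fun x hx hBx => ?_⟩
  by_contra h
  exact absurd (hB x ⟨hx, h⟩) (not_le.2 hBx)

/-- The recession cone of a cobounded convex set is the whole cone. -/
theorem add_mem (hΔ : IsCobounded C Δ) {x c : Fin d → ℝ} (hx : x ∈ Δ) (hc : c ∈ C) :
    x + c ∈ Δ := by
  rcases eq_or_ne c 0 with rfl | hc0
  · rwa [add_zero]
  obtain ⟨B, hB⟩ := hΔ.exists_mem_of_norm_lt
  have hn : 0 < ‖c‖ := norm_pos_iff.2 hc0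
  set t : ℝ := 1 + (|B| + ‖x‖) / ‖c‖ with ht
  have ht1 : 1 ≤ t := by
    have : 0 ≤ (|B| + ‖x‖) / ‖c‖ := by positivity
    linarith
  have ht0 : 0 < t := by linarith
  have hfar : x + t • c ∈ Δ := by
    refine hB _ (C.add_mem (hΔ.subset hx) (C.smul_mem ht0.le hc)) ?_
    have h1 : ‖t • c‖ = ‖c‖ + (|B| + ‖x‖) := by
      rw [norm_smul, Real.norm_of_nonneg ht0.le, ht]
      field_simp
    have h2 : ‖t • c‖ ≤ ‖x + t • c‖ + ‖x‖ := by
      simpa using norm_sub_le (x + t • c) x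
    have := le_abs_self B
    linarith
  have := hΔ.convex hx hfar (a := 1 - t⁻¹) (b := t⁻¹)
    (sub_nonneg.2 (inv_le_one_of_one_le₀ ht1)) (inv_nonneg.2 ht0.le) (by ring)
  convert this using 1
  rw [smul_add, inv_smul_smul₀ ht0.ne', sub_smul, one_smul]
  abel

theorem zero_notMem (hΔ : IsCobounded C Δ) : (0 : Fin d → ℝ) ∉ Δ := by
  intro h0
  obtain ⟨x, hx, hxΔ⟩ := hΔ.compl_nonempty
  exact hxΔ (by simpa using hΔ.add_mem h0 hx)

theorem add_coe (hΔ : IsCobounded C Δ) : Δ + (C : Set (Fin d → ℝ)) = Δ := by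
  refine Set.Subset.antisymm ?_ fun x hx => ⟨x, hx, 0, C.zero_mem, add_zero x⟩
  rintro _ ⟨x, hx, c, hc, rfl⟩
  exact hΔ.add_mem hx hc

/-- Sums of cobounded sets are cobounded. That the sum is closed is assumed: below it follows from
a decomposition of the sets, not from coboundedness alone. -/
theorem add (hC : IsStrictlyConvexCone C) (hΔ : IsCobounded C Δ) (hΔ' : IsCobounded C Δ')
    (hcl : IsClosed (Δ + Δ')) : IsCobounded C (Δ + Δ') where
  subset := by
    rintro _ ⟨x, hx, y, hy, rfl⟩
    exact C.add_mem (hΔ.subset hx) (hΔ'.subset hy)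
  isClosed := hcl
  convex := hΔ.convex.add hΔ'.convex
  isBounded_compl := by
    refine ((hΔ.isBounded_compl.smul₀ (2 : ℝ)).union
      (hΔ'.isBounded_compl.smul₀ (2 : ℝ))).subset ?_
    rintro x ⟨hx, hxn⟩
    have hhalf : (2 : ℝ)⁻¹ • x ∈ C := C.smul_mem (by norm_num) hx
    have hsum : (2 : ℝ)⁻¹ • x + (2 : ℝ)⁻¹ • x = x := by rw [← add_smul]; norm_num
    have h2 : (2 : ℝ) ≠ 0 := two_ne_zero
    simp only [Set.mem_union, Set.mem_smul_set_iff_inv_smul_mem₀ h2]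
    by_contra hcon
    push Not at hcon
    refine hxn ⟨_, not_not.1 fun h => hcon.1 ⟨hhalf, h⟩, _,
      not_not.1 fun h => hcon.2 ⟨hhalf, h⟩, hsum⟩
  compl_nonempty := by
    refine ⟨0, C.zero_mem, ?_⟩
    rintro ⟨x, hx, y, hy, hxy : x + y = 0⟩
    have h0 : x = 0 := hC.lineFree x (hΔ.subset hx) (by
      rw [neg_eq_of_add_eq_zero_right hxy]; exact hΔ'.subset hy)
    exact hΔ.zero_notMem (h0 ▸ hx)

theorem smul (hΔ : IsCobounded C Δ) {c : ℝ} (hc : 0 < c) : IsCobounded C (c • Δ) where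
  subset := by
    have := Set.smul_set_mono (a := c) hΔ.subset
    rwa [smul_coe_pointedCone C hc] at this
  isClosed := hΔ.isClosed.smul_of_ne_zero hc.ne'
  convex := hΔ.convex.smul c
  isBounded_compl := by
    have := hΔ.isBounded_compl.smul₀ c
    rwa [Set.smul_set_sdiff₀ hc.ne', smul_coe_pointedCone C hc] at this
  compl_nonempty := by
    have := hΔ.compl_nonempty.smul_set (a := c)
    rwa [Set.smul_set_sdiff₀ hc.ne', smul_coe_pointedCone C hc] at this

/-- If the cone is not `{0}`, a cobounded set `Δ` is recovered from the coconvex set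
`C \ (Δ ∪ {0})`. -/
theorem unboundedComponent_eq (hΔ : IsCobounded C Δ) {g : Fin d → ℝ} (hg : g ∈ C) (hg0 : g ≠ 0) :
    unboundedComponent C ((C : Set (Fin d → ℝ)) \ (Δ ∪ {0})) = Δ := by
  have hcompl : (C : Set (Fin d → ℝ)) \ ((C : Set (Fin d → ℝ)) \ (Δ ∪ {0})) = Δ ∪ {0} := by
    rw [Set.sdiff_sdiff_right_self, Set.inter_eq_right]
    exact Set.union_subset hΔ.subset (Set.singleton_subset_iff.2 C.zero_mem)
  have hunb : ¬ Bornology.IsBounded Δ := by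
    intro hb
    obtain ⟨B, hB⟩ := (hb.union hΔ.isBounded_compl).exists_norm_le
    have hmem : ((|B| + 1) / ‖g‖) • g ∈ C := C.smul_mem (by positivity) hg
    have := hB (((|B| + 1) / ‖g‖) • g) (by
      by_cases h : ((|B| + 1) / ‖g‖) • g ∈ Δ
      · exact Or.inl h
      · exact Or.inr ⟨hmem, h⟩)
    rw [norm_smul, Real.norm_of_nonneg (by positivity),
      div_mul_cancel₀ _ (norm_ne_zero_iff.2 hg0)] at this
    have := le_abs_self B
    linarith
  ext x
  rw [unboundedComponent, Set.mem_ofPred_eq, hcompl]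
  constructor
  · rintro ⟨hx | rfl, hx'⟩
    · exact hx
    · refine absurd ?_ hx'
      refine (Bornology.isBounded_singleton (x := (0 : Fin d → ℝ))).subset ?_
      set Y := connectedComponentIn (Δ ∪ {0}) (0 : Fin d → ℝ) with hY
      have h0 : (0 : Fin d → ℝ) ∈ Y := mem_connectedComponentIn (by simp)
      have hsub : Y ⊆ Δ ∪ {0} := connectedComponentIn_subset _ _
      intro y hy
      rcases hsub hy with hyΔ | hy0
      · obtain ⟨z, -, hz, hz0⟩ := isPreconnected_closed_iff.1
          (isPreconnected_connectedComponentIn (F := Δ ∪ {0}) (x := (0 : Fin d → ℝ))) Δ {0}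
          hΔ.isClosed isClosed_singleton hsub ⟨y, hy, hyΔ⟩ ⟨0, h0, rfl⟩
        rw [Set.mem_singleton_iff.1 hz0] at hz
        exact absurd hz hΔ.zero_notMem
      · exact hy0
  · intro hx
    exact ⟨Or.inl hx, fun hb => hunb (hb.subset
      (hΔ.convex.isPreconnected.subset_connectedComponentIn hx Set.subset_union_left))⟩

end IsCobounded

/-- The iterated coconvex sum of sets `C \ (Δ i ∪ {0})` is `C \ (∑ i, Δ i ∪ {0})`. The sets `Δ i`
are assumed to be of the form `P + C` with `P` compact, which makes the sums closed. -/
theorem bigOplus_eq_sdiff (hC : IsStrictlyConvexCone C) {g : Fin d → ℝ} (hg : g ∈ C) (hg0 : g ≠ 0)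
    (n : ℕ) (Δ : Fin (n + 1) → Set (Fin d → ℝ)) (hΔ : ∀ i, IsCobounded C (Δ i))
    (hP : ∀ i, ∃ P, IsCompact P ∧ Δ i = P + (C : Set (Fin d → ℝ))) :
    bigOplus C n (fun i => (C : Set (Fin d → ℝ)) \ (Δ i ∪ {0})) =
        (C : Set (Fin d → ℝ)) \ ((∑ i, Δ i) ∪ {0}) ∧
      IsCobounded C (∑ i, Δ i) ∧
      ∃ P, IsCompact P ∧ ∑ i, Δ i = P + (C : Set (Fin d → ℝ)) := by
  induction n with
  | zero =>
    simp only [Fin.sum_univ_succ, Finset.univ_eq_empty, Finset.sum_empty, add_zero]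
    exact ⟨rfl, hΔ 0, hP 0⟩
  | succ n ih =>
    obtain ⟨h1, h2, P, hPc, hPe⟩ := ih (fun i => Δ i.castSucc) (fun i => hΔ _) (fun i => hP _)
    obtain ⟨P', hPc', hPe'⟩ := hP (Fin.last (n + 1))
    rw [Fin.sum_univ_castSucc]
    have hsum : ∑ i : Fin (n + 1), Δ i.castSucc + Δ (Fin.last (n + 1)) =
        P + P' + (C : Set (Fin d → ℝ)) := by
      rw [hPe, hPe', add_add_add_comm, coe_add_coe_pointedCone]
    refine ⟨?_, h2.add hC (hΔ _) ?_, P + P', hPc.add hPc', hsum⟩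
    · rw [bigOplus, h1, oplus, h2.unboundedComponent_eq hg hg0,
        (hΔ _).unboundedComponent_eq hg hg0]
    · rw [hsum]
      exact hC.isClosed.add_left_of_isCompact (hPc.add hPc')

/-! ### Generators of the cone -/

variable {ι : Type*} [Fintype ι] {g : ι → Fin d → ℝ}

theorem mem_hull_range {x : Fin d → ℝ} :
    x ∈ PointedCone.hull ℝ (Set.range g) ↔
      ∃ a : ι → ℝ, (∀ i, 0 ≤ a i) ∧ ∑ i, a i • g i = x := by
  rw [Submodule.mem_span_range_iff_exists_fun]
  constructor
  · rintro ⟨c, rfl⟩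
    exact ⟨fun i => c i, fun i => (c i).2, rfl⟩
  · rintro ⟨a, ha, rfl⟩
    exact ⟨fun i => ⟨a i, ha i⟩, rfl⟩

/-- A line-free cone lies, up to the apex, in an open half-space. -/
theorem exists_functional_one_le (hg0 : ∀ i, g i ≠ 0)
    (hline : ∀ x ∈ PointedCone.hull ℝ (Set.range g),
      -x ∈ PointedCone.hull ℝ (Set.range g) → x = 0) :
    ∃ l : (Fin d → ℝ) →L[ℝ] ℝ, ∀ i, 1 ≤ l (g i) := by
  rcases isEmpty_or_nonempty ι with h | h
  · exact ⟨0, fun i => isEmptyElim i⟩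
  have h0 : (0 : Fin d → ℝ) ∉ convexHull ℝ (Set.range g) := by
    intro h0
    rw [← one_smul ℝ (convexHull ℝ (Set.range g)),
      mem_smul_convexHull_range g zero_le_one] at h0
    obtain ⟨a, ha, hs, h0⟩ := h0
    have hall : ∀ i, a i = 0 := by
      classical
      intro i
      have h1 : a i • g i = 0 := by
        refine hline _ (Submodule.smul_mem _ (⟨a i, ha i⟩ : NNReal)
          (Submodule.subset_span ⟨i, rfl⟩)) ?_
        rw [← Finset.add_sum_erase _ _ (Finset.mem_univ i)] at h0
        rw [neg_eq_of_add_eq_zero_right h0]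
        exact Submodule.sum_mem _ fun j _ => Submodule.smul_mem _ (⟨a j, ha j⟩ : NNReal)
          (Submodule.subset_span ⟨j, rfl⟩)
      exact (smul_eq_zero.1 h1).resolve_right (hg0 i)
    simp [hall] at hs
  obtain ⟨f, u, hu, hf⟩ := geometric_hahn_banach_point_closed (convex_convexHull ℝ _)
    ((Set.finite_range g).isClosed_convexHull ℝ) h0
  rw [map_zero] at hu
  refine ⟨u⁻¹ • f, fun i => ?_⟩
  have := hf _ (subset_convexHull ℝ _ ⟨i, rfl⟩)
  rw [smul_apply, smul_eq_mul, inv_mul_eq_div, le_div_iff₀ hu, one_mul]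
  exact this.le

/-- A functional that is positive on the generators has bounded sublevel sets on the cone. -/
theorem isBounded_sublevel (f : (Fin d → ℝ) →L[ℝ] ℝ) (hf : ∀ i, 0 < f (g i)) (t : ℝ) :
    Bornology.IsBounded {x | x ∈ PointedCone.hull ℝ (Set.range g) ∧ f x ≤ t} := by
  refine isBounded_iff_forall_norm_le.2 ⟨∑ i, (t / f (g i)) * ‖g i‖, ?_⟩
  rintro x ⟨hx, hxt⟩
  obtain ⟨a, ha, rfl⟩ := mem_hull_range.1 hx
  refine (norm_sum_le _ _).trans (Finset.sum_le_sum fun i _ => ?_)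
  rw [norm_smul, Real.norm_of_nonneg (ha i)]
  refine mul_le_mul_of_nonneg_right ?_ (norm_nonneg _)
  rw [le_div_iff₀ (hf i)]
  refine le_trans ?_ hxt
  rw [map_sum]
  simp only [map_smul, smul_eq_mul]
  exact Finset.single_le_sum (f := fun i => a i * f (g i))
    (fun j _ => mul_nonneg (ha j) (hf j).le) (Finset.mem_univ i)

theorem nonneg_of_mem_hull (f : (Fin d → ℝ) →L[ℝ] ℝ) (hf : ∀ i, 0 ≤ f (g i)) {x : Fin d → ℝ}
    (hx : x ∈ PointedCone.hull ℝ (Set.range g)) : 0 ≤ f x := by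
  obtain ⟨a, ha, rfl⟩ := mem_hull_range.1 hx
  rw [map_sum]
  simp only [map_smul, smul_eq_mul]
  exact Finset.sum_nonneg fun i _ => mul_nonneg (ha i) (hf i)

/-! ### Cobounded sets with lattice vertices -/

variable {Δ : Set (Fin d → ℝ)}

/-- A functional that is positive on the generators attains its minimum on `Δ` at a vertex. -/
theorem IsCobounded.exists_extremePoint_isMin
    (hΔ : IsCobounded (PointedCone.hull ℝ (Set.range g)) Δ) (hne : Δ.Nonempty)
    (f : (Fin d → ℝ) →L[ℝ] ℝ) (hf : ∀ i, 0 < f (g i)) :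
    ∃ v ∈ Δ.extremePoints ℝ, ∀ x ∈ Δ, f v ≤ f x := by
  have hcomp : ∀ t, IsCompact (Δ ∩ {x | f x ≤ t}) := fun t =>
    Metric.isCompact_of_isClosed_isBounded
      (hΔ.isClosed.inter (isClosed_le f.continuous continuous_const))
      ((isBounded_sublevel f hf t).subset fun x hx => ⟨hΔ.subset hx.1, hx.2⟩)
  obtain ⟨x₀, hx₀⟩ := hne
  obtain ⟨x₁, hx₁, hmin⟩ := (hcomp (f x₀)).exists_isMinOn ⟨x₀, hx₀, le_refl (f x₀)⟩
    f.continuous.continuousOn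
  have hmin' : ∀ x ∈ Δ, f x₁ ≤ f x := by
    intro x hx
    rcases le_total (f x) (f x₀) with h | h
    · exact hmin ⟨hx, h⟩
    · exact hx₁.2.trans h
  have hexp : IsExposed ℝ Δ (Δ ∩ {x | f x ≤ f x₁}) := by
    intro _
    refine ⟨-f, ?_⟩
    ext x
    simp only [Set.mem_inter_iff, Set.mem_ofPred_eq, neg_apply, neg_le_neg_iff]
    exact and_congr_right fun hx => ⟨fun h y hy => h.trans (hmin' y hy), fun h => h _ hx₁.1⟩
  obtain ⟨v, hv⟩ := (hcomp (f x₁)).extremePoints_nonempty ⟨x₁, hx₁.1, le_refl (f x₁)⟩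
  refine ⟨v, hexp.isExtreme.extremePoints_subset_extremePoints hv, fun x hx => ?_⟩
  exact (show f v ≤ f x₁ from hv.1.2).trans (hmin' x hx)

/-- A cobounded set with lattice vertices has finitely many of them: the midpoint between the
apex and a vertex is not in `Δ`. -/
theorem IsCobounded.finite_vertices (hΔ : IsCobounded C Δ) :
    {z : Fin d → ℤ | latticePoint z ∈ Δ.extremePoints ℝ}.Finite := by
  obtain ⟨B, hB⟩ := hΔ.exists_mem_of_norm_lt
  refine (Set.finite_Icc (fun _ => -⌈2 * B⌉ : Fin d → ℤ) (fun _ => ⌈2 * B⌉)).subset ?_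
  intro z hz
  have hzΔ : latticePoint z ∈ Δ := hz.1
  have hhalf : (2 : ℝ)⁻¹ • latticePoint z ∉ Δ := by
    intro h
    have hC : (2 : ℝ)⁻¹ • latticePoint z ∈ C := hΔ.subset h
    have h3 := hΔ.add_mem hzΔ hC
    have := hz.2 h h3 ⟨2⁻¹, 2⁻¹, by norm_num, by norm_num, by norm_num, by
      simp only [smul_add, smul_smul, ← add_smul]; norm_num⟩
    have h0 : latticePoint z = 0 := by
      have h4 : (2 : ℝ)⁻¹ • latticePoint z + (2 : ℝ)⁻¹ • latticePoint z = latticePoint z := by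
        rw [← add_smul]; norm_num
      rw [this] at h4
      simpa using h4
    exact hΔ.zero_notMem (h0 ▸ hzΔ)
  have hnorm : ‖latticePoint z‖ ≤ 2 * B := by
    by_contra hcon
    refine hhalf (hB _ (C.smul_mem (by norm_num) (hΔ.subset hzΔ)) ?_)
    rw [norm_smul, Real.norm_of_nonneg (by norm_num)]
    linarith
  have hi : ∀ i, |z i| ≤ ⌈2 * B⌉ := by
    intro i
    have h1 := (norm_le_pi_norm (latticePoint z) i).trans hnorm
    rw [Real.norm_eq_abs, latticePoint, ← Int.cast_abs] at h1
    exact_mod_cast h1.trans (Int.le_ceil _)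
  exact ⟨fun i => (abs_le.1 (hi i)).1, fun i => (abs_le.1 (hi i)).2⟩

/-- A cobounded set is the sum of the cone and the convex hull of its vertices, if it has finitely
many of them. -/
theorem IsCobounded.eq_convexHull_add
    (hΔ : IsCobounded (PointedCone.hull ℝ (Set.range g)) Δ) (hne : Δ.Nonempty)
    (hcl : IsClosed (PointedCone.hull ℝ (Set.range g) : Set (Fin d → ℝ)))
    (l : (Fin d → ℝ) →L[ℝ] ℝ) (hl : ∀ i, 1 ≤ l (g i)) (hfin : (Δ.extremePoints ℝ).Finite) :
    Δ = convexHull ℝ (Δ.extremePoints ℝ) +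
      (PointedCone.hull ℝ (Set.range g) : Set (Fin d → ℝ)) := by
  set C := PointedCone.hull ℝ (Set.range g) with hCdef
  have hl0 : ∀ i, 0 < l (g i) := fun i => zero_lt_one.trans_le (hl i)
  refine Set.Subset.antisymm (fun x hx => ?_) ?_
  · by_contra hxn
    obtain ⟨f, u, hu, hf⟩ := geometric_hahn_banach_point_closed
      ((convex_convexHull ℝ _).add (convex_coe_pointedCone C))
      (hcl.add_left_of_isCompact (hfin.isCompact_convexHull ℝ)) hxn
    have hfv : ∀ v ∈ Δ.extremePoints ℝ, ∀ c ∈ C, u < f v + f c := fun v hv c hc => by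
      rw [← map_add]
      exact hf _ ⟨v, subset_convexHull ℝ _ hv, c, hc, rfl⟩
    obtain ⟨v₀, hv₀, -⟩ := hΔ.exists_extremePoint_isMin hne l hl0
    have hfC : ∀ i, 0 ≤ f (g i) := by
      intro i
      by_contra hneg
      push Not at hneg
      have hgi : g i ∈ C := Submodule.subset_span ⟨i, rfl⟩
      have h1 := hfv v₀ hv₀ 0 C.zero_mem
      rw [map_zero, add_zero] at h1
      have h2 := hfv v₀ hv₀ (((u - f v₀) / f (g i)) • g i)
        (C.smul_mem (div_nonneg_of_nonpos (by linarith) hneg.le) hgi)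
      rw [map_smul, smul_eq_mul, div_mul_cancel₀ _ hneg.ne] at h2
      linarith
    -- `f + ε • l` is positive on the generators and still separates
    have hlx : 0 ≤ l x := nonneg_of_mem_hull l (fun i => (hl0 i).le) (hΔ.subset hx)
    set ε : ℝ := (u - f x) / (l x + 1) with hε
    have hε0 : 0 < ε := div_pos (by linarith) (by linarith)
    obtain ⟨v, hv, hmin⟩ := hΔ.exists_extremePoint_isMin hne (f + ε • l) fun i => by
      simpa using add_pos_of_nonneg_of_pos (hfC i) (mul_pos hε0 (hl0 i))
    have h1 := hmin x hx
    have h2 := hfv v hv 0 C.zero_mem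
    have hlv : 0 ≤ l v := nonneg_of_mem_hull l (fun i => (hl0 i).le) (hΔ.subset hv.1)
    simp only [add_apply, smul_apply, smul_eq_mul] at h1
    rw [map_zero, add_zero] at h2
    have h3 : ε * (l x + 1) = u - f x := div_mul_cancel₀ _ (by linarith)
    nlinarith [mul_nonneg hε0.le hlv]
  · rintro _ ⟨p, hp, c, hc, rfl⟩
    exact hΔ.add_mem (convexHull_min extremePoints_subset hΔ.convex hp) hc

end Cobounded

/-! ### Coconvex sets as differences of Minkowski sums -/

section Truncation

variable {d : ℕ} {ι : Type*} [Fintype ι] {g : ι → Fin d → ℝ}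

/-- The convex hull of the apex and of the generators `g i` of a cone. -/
def capPolytope {ι : Type*} (g : ι → Fin d → ℝ) : Set (Fin d → ℝ) :=
  convexHull ℝ (Set.range fun o : Option ι => o.elim 0 g)

theorem mem_smul_capPolytope {r : ℝ} (hr : 0 ≤ r) {x : Fin d → ℝ} :
    x ∈ r • capPolytope g ↔ ∃ a : ι → ℝ, (∀ i, 0 ≤ a i) ∧ ∑ i, a i ≤ r ∧ ∑ i, a i • g i = x := by
  rw [capPolytope, mem_smul_convexHull_range _ hr]
  constructor
  · rintro ⟨a, ha, hs, rfl⟩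
    rw [Fintype.sum_option] at hs
    refine ⟨fun i => a (some i), fun i => ha _, by linarith [ha none], ?_⟩
    simp [Fintype.sum_option]
  · rintro ⟨a, ha, hs, rfl⟩
    refine ⟨fun o => o.elim (r - ∑ i, a i) a, fun o => ?_, ?_, ?_⟩
    · cases o with
      | none => exact sub_nonneg.2 hs
      | some i => exact ha i
    · simp [Fintype.sum_option]
    · simp [Fintype.sum_option]

theorem capPolytope_subset {ι : Type*} {g : ι → Fin d → ℝ} :
    capPolytope g ⊆ PointedCone.hull ℝ (Set.range g) := by
  refine convexHull_min ?_ (convex_coe_pointedCone _)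
  rintro _ ⟨o, rfl⟩
  cases o with
  | none => exact Submodule.zero_mem _
  | some i => exact Submodule.subset_span ⟨i, rfl⟩

/-- The complement of `P + C` in the cone `C` as a difference of two polytopes. Here `Pt` is a
subset of the cone that contains `P` and the apex and can be moved into `P` along each of the
generators. If a point of `Pt + r • Γ` has a large coordinate along some generator, it therefore
lies in `P + r • Γ`; otherwise it is so close to the apex that it does so as soon as it lies in
`P + C`. -/
theorem sdiff_add_cone_eq (l : (Fin d → ℝ) →L[ℝ] ℝ) (hl : ∀ i, 1 ≤ l (g i))
    {P Pt : Set (Fin d → ℝ)} (hPPt : P ⊆ Pt) (h0 : (0 : Fin d → ℝ) ∈ Pt)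
    (hPt : Pt ⊆ PointedCone.hull ℝ (Set.range g)) {s₀ b t r : ℝ}
    (hmove : ∀ q ∈ Pt, ∀ i, ∃ s, 0 ≤ s ∧ s ≤ s₀ ∧ q + s • g i ∈ P)
    (hb : ∀ q ∈ Pt, l q ≤ b)
    (hfar : ∀ x ∈ PointedCone.hull ℝ (Set.range g), t < l x →
      x ∈ P + (PointedCone.hull ℝ (Set.range g) : Set (Fin d → ℝ)))
    (hr : 0 ≤ r) (htr : t ≤ r) (hbr : b + s₀ * ∑ i, l (g i) ≤ r) :
    (PointedCone.hull ℝ (Set.range g) : Set (Fin d → ℝ)) \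
        (P + (PointedCone.hull ℝ (Set.range g) : Set (Fin d → ℝ))) =
      (Pt + r • capPolytope g) \ (P + r • capPolytope g) := by
  classical
  set C := PointedCone.hull ℝ (Set.range g) with hCdef
  have hl0 : ∀ i, 0 ≤ l (g i) := fun i => zero_le_one.trans (hl i)
  have hcap : r • capPolytope g ⊆ (C : Set (Fin d → ℝ)) := by
    rintro _ ⟨x, hx, rfl⟩
    exact C.smul_mem hr (capPolytope_subset hx)
  have hle : ∀ a : ι → ℝ, (∀ i, 0 ≤ a i) → ∑ i, a i ≤ l (∑ i, a i • g i) := by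
    intro a ha
    rw [map_sum]
    refine Finset.sum_le_sum fun i _ => ?_
    rw [map_smul, smul_eq_mul]
    exact le_mul_of_one_le_right (ha i) (hl i)
  ext x
  constructor
  · rintro ⟨hx, hxn⟩
    refine ⟨⟨0, h0, x, ?_, zero_add x⟩, fun h => hxn (Set.add_subset_add_left hcap h)⟩
    have hxt : l x ≤ t := not_lt.1 fun h => hxn (hfar x hx h)
    obtain ⟨a, ha, rfl⟩ := mem_hull_range.1 hx
    exact (mem_smul_capPolytope hr).2 ⟨a, ha, (hle a ha).trans (hxt.trans htr), rfl⟩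
  · rintro ⟨⟨q, hq, n, hn, rfl⟩, hxn⟩
    refine ⟨C.add_mem (hPt hq) (hcap hn), ?_⟩
    rintro ⟨p, hp, c, hc, hpc⟩
    obtain ⟨a, ha, hsum, rfl⟩ := (mem_smul_capPolytope hr).1 hn
    by_cases hbig : ∃ i, s₀ ≤ a i
    · obtain ⟨i, hi⟩ := hbig
      obtain ⟨s, hs, hs', hqs⟩ := hmove q hq i
      refine hxn ⟨_, hqs, ∑ j, (a j - if j = i then s else 0) • g j,
        (mem_smul_capPolytope hr).2 ⟨_, fun j => ?_, ?_, rfl⟩, ?_⟩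
      · by_cases hj : j = i
        · subst hj; simpa using hs'.trans hi
        · simpa [hj] using ha j
      · simp only [Finset.sum_sub_distrib, Finset.sum_ite_eq', Finset.mem_univ, if_true]
        linarith
      · simp only [sub_smul, ite_smul, zero_smul, Finset.sum_sub_distrib, Finset.sum_ite_eq',
          Finset.mem_univ, if_true]
        abel
    · push Not at hbig
      have hln : l (∑ i, a i • g i) ≤ s₀ * ∑ i, l (g i) := by
        rw [map_sum, Finset.mul_sum]
        refine Finset.sum_le_sum fun i _ => ?_
        rw [map_smul, smul_eq_mul]
        exact mul_le_mul_of_nonneg_right (hbig i).le (hl0 i)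
      have hlx : l p + l c ≤ b + s₀ * ∑ i, l (g i) := by
        have : l p + l c = l q + l (∑ i, a i • g i) := by
          rw [← map_add, ← map_add]; exact congrArg l hpc
        rw [this]
        exact add_le_add (hb q hq) hln
      have hlp : 0 ≤ l p := nonneg_of_mem_hull l hl0 (hPt (hPPt hp))
      obtain ⟨e, he, rfl⟩ := mem_hull_range.1 hc
      refine hxn ⟨p, hp, _, (mem_smul_capPolytope hr).2 ⟨e, he, ?_, rfl⟩, hpc⟩
      have := hle e he
      linarith

theorem sum_smul_eq_of_convex {κ : Type*} (s : Finset κ) {m : κ → ℝ} (hm : ∀ i ∈ s, 0 ≤ m i)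
    {X : Set (Fin d → ℝ)} (hX : Convex ℝ X) (hne : X.Nonempty) :
    ∑ i ∈ s, m i • X = (∑ i ∈ s, m i) • X := by
  classical
  induction s using Finset.induction_on with
  | empty => rw [Finset.sum_empty, Finset.sum_empty, Set.zero_smul_set hne]
  | insert i s hi ih =>
    rw [Finset.sum_insert hi, Finset.sum_insert hi,
      ih fun j hj => hm j (Finset.mem_insert_of_mem hj),
      hX.add_smul (hm i (Finset.mem_insert_self _ _))
        (Finset.sum_nonneg fun j hj => hm j (Finset.mem_insert_of_mem hj))]

/-- A cobounded set with lattice vertices is the sum of the cone and an integer polytope that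
contains prescribed multiples of the generators. -/
theorem IsCobounded.exists_convexHull_add_eq {z : ι → Fin d → ℤ} {Δ : Set (Fin d → ℝ)}
    (hΔ : IsCobounded (PointedCone.hull ℝ (Set.range fun i => latticePoint (z i))) Δ)
    (hne : Δ.Nonempty)
    (hcl : IsClosed (PointedCone.hull ℝ (Set.range fun i => latticePoint (z i)) :
      Set (Fin d → ℝ)))
    (l : (Fin d → ℝ) →L[ℝ] ℝ) (hl : ∀ i, 1 ≤ l (latticePoint (z i)))
    (hv : ∀ v ∈ Δ.extremePoints ℝ, ∃ w : Fin d → ℤ, v = latticePoint w)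
    {N : ℕ} (hN : ∀ i, (N : ℝ) • latticePoint (z i) ∈ Δ) :
    ∃ W : Set (Fin d → ℤ), W.Finite ∧ W.Nonempty ∧ (∀ i, N • z i ∈ W) ∧
      Δ = convexHull ℝ (latticePoint '' W) +
        (PointedCone.hull ℝ (Set.range fun i => latticePoint (z i)) : Set (Fin d → ℝ)) := by
  have himg : latticePoint '' {w : Fin d → ℤ | latticePoint w ∈ Δ.extremePoints ℝ} =
      Δ.extremePoints ℝ := by
    ext v
    constructor
    · rintro ⟨w, hw, rfl⟩
      exact hw
    · intro hv'
      obtain ⟨w, rfl⟩ := hv v hv'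
      exact ⟨w, hv', rfl⟩
  have hfin : (Δ.extremePoints ℝ).Finite := himg ▸ hΔ.finite_vertices.image _
  obtain ⟨v, hv', -⟩ := hΔ.exists_extremePoint_isMin hne l fun i => zero_lt_one.trans_le (hl i)
  obtain ⟨w, rfl⟩ := hv v hv'
  refine ⟨{w | latticePoint w ∈ Δ.extremePoints ℝ} ∪ Set.range fun i => N • z i,
    hΔ.finite_vertices.union (Set.finite_range _), ⟨w, Or.inl hv'⟩,
    fun i => Or.inr ⟨i, rfl⟩, Set.Subset.antisymm ?_ ?_⟩
  · refine (hΔ.eq_convexHull_add hne hcl l hl hfin).subset.trans ?_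
    refine Set.add_subset_add_right (convexHull_mono ?_)
    rw [Set.image_union, himg]
    exact Set.subset_union_left
  · rintro _ ⟨p, hp, c, hc, rfl⟩
    refine hΔ.add_mem (convexHull_min ?_ hΔ.convex hp) hc
    rw [Set.image_union, himg]
    refine Set.union_subset extremePoints_subset ?_
    rintro _ ⟨_, ⟨i, rfl⟩, rfl⟩
    rw [latticePoint_nsmul]
    exact hN i

/-- Minkowski combinations of cobounded sets with lattice vertices have complements that are
differences of the corresponding Minkowski combinations of integer polytopes. -/
theorem exists_integerPolytopes_sdiff_eq {κ : Type*} [Fintype κ] [Nonempty κ]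
    {z : ι → Fin d → ℤ} {C : PointedCone ℝ (Fin d → ℝ)} (hC : IsStrictlyConvexCone C)
    (hCz : C = PointedCone.hull ℝ (Set.range fun i => latticePoint (z i)))
    (hz : ∀ i, z i ≠ 0) (hne : Nonempty ι) {Δ : κ → Set (Fin d → ℝ)}
    (hΔ : ∀ j, IsCobounded C (Δ j))
    (hv : ∀ j, ∀ v ∈ (Δ j).extremePoints ℝ, ∃ w : Fin d → ℤ, v = latticePoint w) :
    (∀ j, ∃ P, IsCompact P ∧ Δ j = P + (C : Set (Fin d → ℝ))) ∧
    ∃ B D : κ → Set (Fin d → ℝ),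
      (∀ j, IsIntegerPolytope (B j) ∧ (B j).Nonempty ∧ IsIntegerPolytope (D j) ∧
        (D j).Nonempty ∧ D j ⊆ B j) ∧
      ∀ m : κ → ℝ, (∀ j, 0 < m j) →
        (C : Set (Fin d → ℝ)) \ ∑ j, m j • Δ j = (∑ j, m j • B j) \ ∑ j, m j • D j := by
  classical
  have hz0 : ∀ i, latticePoint (z i) ≠ 0 := fun i h =>
    hz i (latticePoint_injective (h.trans latticePoint_zero.symm))
  obtain ⟨l, hl⟩ := exists_functional_one_le hz0 (hCz ▸ hC.lineFree)
  have hzC : ∀ i, latticePoint (z i) ∈ C := fun i => hCz ▸ Submodule.subset_span ⟨i, rfl⟩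
  -- a bound for all the bounded sets `C \ Δ j`
  obtain ⟨b₀, hb₀⟩ := (Bornology.isBounded_iUnion.2 fun j =>
    (hΔ j).isBounded_compl).exists_norm_le
  have hmem : ∀ j, ∀ x ∈ C, b₀ < ‖x‖ → x ∈ Δ j := by
    intro j x hx hbx
    by_contra h
    exact absurd (hb₀ x (Set.mem_iUnion.2 ⟨j, hx, h⟩)) (not_le.2 hbx)
  obtain ⟨N, hN⟩ : ∃ N : ℕ, ∀ i, b₀ < N * ‖latticePoint (z i)‖ :=
    (Filter.eventually_all.2 fun i => ((tendsto_natCast_atTop_atTop (R := ℝ)).atTop_mul_const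
      (norm_pos_iff.2 (hz0 i))).eventually_gt_atTop b₀).exists
  have hNΔ : ∀ j i, (N : ℝ) • latticePoint (z i) ∈ Δ j := fun j i => by
    refine hmem j _ (C.smul_mem (Nat.cast_nonneg N) (hzC i)) ?_
    rw [norm_smul, Real.norm_of_nonneg (Nat.cast_nonneg N)]
    exact hN i
  obtain ⟨i₀⟩ := hne
  have hW : ∀ j, ∃ W : Set (Fin d → ℤ), W.Finite ∧ W.Nonempty ∧ (∀ i, N • z i ∈ W) ∧
      Δ j = convexHull ℝ (latticePoint '' W) + (C : Set (Fin d → ℝ)) := by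
    intro j
    subst hCz
    exact (hΔ j).exists_convexHull_add_eq ⟨_, hNΔ j i₀⟩ hC.isClosed l hl (hv j) (hNΔ j)
  choose W hWfin hWne hNW hWΔ using hW
  set P : κ → Set (Fin d → ℝ) := fun j => convexHull ℝ (latticePoint '' W j) with hP
  set Pt : κ → Set (Fin d → ℝ) := fun j => convexHull ℝ (latticePoint '' insert 0 (W j)) with hPt
  have hPPt : ∀ j, P j ⊆ Pt j := fun j =>
    convexHull_mono (Set.image_mono (Set.subset_insert _ _))
  have hPne : ∀ j, (P j).Nonempty := fun j => ((hWne j).image _).convexHull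
  have hPint : ∀ j, IsIntegerPolytope (P j) := fun j => isIntegerPolytope_of_finite (hWfin j)
  have hPtint : ∀ j, IsIntegerPolytope (Pt j) := fun j =>
    isIntegerPolytope_of_finite ((hWfin j).insert 0)
  have hPtcone : ∀ j, Pt j ⊆ C := by
    intro j
    refine convexHull_min ?_ (convex_coe_pointedCone C)
    rw [Set.image_insert_eq, latticePoint_zero]
    refine Set.insert_subset C.zero_mem fun x hx => (hΔ j).subset ?_
    rw [hWΔ j]
    exact ⟨x, subset_convexHull ℝ _ hx, 0, C.zero_mem, add_zero x⟩
  have hmove : ∀ j, ∀ q ∈ Pt j, ∀ i, ∃ s : ℝ, 0 ≤ s ∧ s ≤ N ∧ q + s • latticePoint (z i) ∈ P j := by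
    intro j q hq i
    rw [hPt] at hq
    simp only [Set.image_insert_eq, latticePoint_zero] at hq
    rw [convexHull_insert ((hWne j).image _)] at hq
    obtain ⟨_, rfl, p, hp, a, c, ha, hc, hac, rfl⟩ := mem_convexJoin.1 hq
    refine ⟨a * N, by positivity, mul_le_of_le_one_left (Nat.cast_nonneg N) (by linarith), ?_⟩
    have := convex_convexHull ℝ (latticePoint '' W j)
      (subset_convexHull ℝ _ ⟨_, hNW j i, rfl⟩) hp ha hc hac
    rw [latticePoint_nsmul] at this
    rw [smul_zero, zero_add, mul_smul, add_comm]
    exact this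
  obtain ⟨b, hb⟩ : ∃ b : ℝ, ∀ j, ∀ q ∈ Pt j, l q ≤ b := by
    obtain ⟨b, hb⟩ := ((isCompact_iUnion fun j => (hPtint j).isCompact).image
      l.continuous).bddAbove
    exact ⟨b, fun j q hq => hb ⟨q, Set.mem_iUnion.2 ⟨j, hq⟩, rfl⟩⟩
  have hfar : ∀ j, ∀ x ∈ C, ‖l‖ * b₀ < l x → x ∈ Δ j := by
    intro j x hx hlx
    refine hmem j x hx (lt_of_mul_lt_mul_left (hlx.trans_le ?_) (norm_nonneg l))
    exact (le_abs_self _).trans (l.le_opNorm x)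
  obtain ⟨R, hR⟩ := exists_nat_ge
    (max (‖l‖ * b₀) (b + N * ∑ i, l (latticePoint (z i))))
  set Γ := capPolytope fun i => latticePoint (z i) with hΓ
  have hΓint : IsIntegerPolytope Γ := by
    have := isIntegerPolytope_of_finite (Set.finite_range fun o : Option ι => o.elim 0 z)
    rw [← Set.range_comp] at this
    rw [hΓ, capPolytope]
    convert this using 3
    ext o : 1
    cases o <;> simp
  have hΓne : Γ.Nonempty := (Set.range_nonempty _).convexHull
  refine ⟨fun j => ⟨P j, (hPint j).isCompact, hWΔ j⟩, fun j => Pt j + (R : ℝ) • Γ,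
    fun j => P j + (R : ℝ) • Γ, fun j => ⟨(hPtint j).add (hΓint.nsmul R),
      ((hPne j).mono (hPPt j)).add hΓne.smul_set, (hPint j).add (hΓint.nsmul R),
      (hPne j).add hΓne.smul_set, Set.add_subset_add_right (hPPt j)⟩, fun m hm => ?_⟩
  have hm0 : ∀ j ∈ Finset.univ, 0 ≤ m j := fun j _ => (hm j).le
  set M := ∑ j, m j with hM
  have hMpos : 0 < M := Finset.sum_pos (fun j _ => hm j) Finset.univ_nonempty
  have hsumcone : ∑ j, m j • (C : Set (Fin d → ℝ)) = C := by
    rw [sum_smul_eq_of_convex _ hm0 (convex_coe_pointedCone C) ⟨0, C.zero_mem⟩,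
      smul_coe_pointedCone C hMpos]
  have hΔsum : ∑ j, m j • Δ j = ∑ j, m j • P j + (C : Set (Fin d → ℝ)) := by
    conv_lhs => enter [2, j]; rw [hWΔ j, smul_add]
    rw [Finset.sum_add_distrib, hsumcone]
  have hcapsum : ∀ X : κ → Set (Fin d → ℝ),
      ∑ j, m j • (X j + (R : ℝ) • Γ) = ∑ j, m j • X j + (M * R) • Γ := by
    intro X
    simp only [smul_add]
    rw [Finset.sum_add_distrib, sum_smul_eq_of_convex _ hm0 (hΓint.convex.smul _)
      hΓne.smul_set, mul_smul]
  rw [hcapsum, hcapsum, hΔsum]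
  have hmem_sum : ∀ {X : κ → Set (Fin d → ℝ)} {x : Fin d → ℝ}, x ∈ ∑ j, m j • X j ↔
      ∃ y : κ → Fin d → ℝ, (∀ j, y j ∈ X j) ∧ ∑ j, m j • y j = x := by
    intro X x
    rw [Set.mem_fintype_sum]
    constructor
    · rintro ⟨y, hy, rfl⟩
      choose e he hey using hy
      exact ⟨e, he, by simp only [← hey]⟩
    · rintro ⟨y, hy, rfl⟩
      exact ⟨fun j => m j • y j, fun j => Set.smul_mem_smul_set (hy j), rfl⟩
  subst hCz
  refine sdiff_add_cone_eq l hl (s₀ := M * N) (b := M * b) (t := M * (‖l‖ * b₀)) ?_ ?_ ?_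
    ?_ ?_ ?_ (by positivity) ?_ ?_
  · intro x hx
    obtain ⟨y, hy, rfl⟩ := hmem_sum.1 hx
    exact hmem_sum.2 ⟨y, fun j => hPPt j (hy j), rfl⟩
  · refine hmem_sum.2 ⟨0, fun j => ?_, by simp⟩
    exact subset_convexHull ℝ _ ⟨0, Set.mem_insert _ _, latticePoint_zero⟩
  · intro x hx
    obtain ⟨y, hy, rfl⟩ := hmem_sum.1 hx
    exact Submodule.sum_mem _ fun j _ =>
      PointedCone.smul_mem _ (hm j).le (hPtcone j (hy j))
  · intro q hq i
    obtain ⟨y, hy, rfl⟩ := hmem_sum.1 hq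
    choose s hs hs' hsP using fun j => hmove j (y j) (hy j) i
    refine ⟨∑ j, m j * s j, Finset.sum_nonneg fun j _ => mul_nonneg (hm j).le (hs j), ?_,
      hmem_sum.2 ⟨_, hsP, ?_⟩⟩
    · rw [hM, Finset.sum_mul]
      exact Finset.sum_le_sum fun j _ => mul_le_mul_of_nonneg_left (hs' j) (hm j).le
    · simp only [smul_add, Finset.sum_add_distrib, Finset.sum_smul, mul_smul]
  · intro q hq
    obtain ⟨y, hy, rfl⟩ := hmem_sum.1 hq
    rw [map_sum, hM, Finset.sum_mul]
    refine Finset.sum_le_sum fun j _ => ?_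
    rw [map_smul, smul_eq_mul]
    exact mul_le_mul_of_nonneg_left (hb j _ (hy j)) (hm j).le
  · intro x hx hlx
    rw [← hΔsum]
    refine hmem_sum.2 ⟨fun _ => M⁻¹ • x, fun j => ?_, ?_⟩
    · refine hfar j _ (PointedCone.smul_mem _ (inv_nonneg.2 hMpos.le) hx) ?_
      rw [map_smul, smul_eq_mul, inv_mul_eq_div, lt_div_iff₀ hMpos, mul_comm]
      exact hlx
    · rw [← Finset.sum_smul, ← hM, smul_inv_smul₀ hMpos.ne']
  · exact mul_le_mul_of_nonneg_left ((le_max_left _ _).trans hR) hMpos.le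
  · have := mul_le_mul_of_nonneg_left ((le_max_right _ _).trans hR) hMpos.le
    linarith

end Truncation

/-! ### Coconvex integer polytopes -/

/-- A cone that is the set of nonnegative combinations of finitely many lattice vectors is the
cone of a finite family of nonzero lattice vectors. -/
theorem IsIntegerCone.exists_family {d : ℕ} {C : PointedCone ℝ (Fin d → ℝ)}
    (hC : IsIntegerCone C) : ∃ S : Finset (Fin d → ℤ), 0 ∉ S ∧
      C = PointedCone.hull ℝ (Set.range fun i : S => latticePoint (i : Fin d → ℤ)) := by
  classical
  obtain ⟨S, rfl⟩ := hC
  refine ⟨S.erase 0, Finset.notMem_erase 0 S, le_antisymm ?_ ?_⟩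
  · refine Submodule.span_le.2 ?_
    rintro _ ⟨w, hw, rfl⟩
    by_cases h0 : w = 0
    · rw [h0, latticePoint_zero]
      exact Submodule.zero_mem _
    · exact Submodule.subset_span ⟨⟨w, Finset.mem_erase.2 ⟨h0, hw⟩⟩, rfl⟩
  · refine Submodule.span_mono ?_
    rintro _ ⟨⟨w, hw⟩, rfl⟩
    exact ⟨w, Finset.mem_of_mem_erase hw, rfl⟩

theorem addContent_sdiff_eq_sub {α K : Type*} [AddCommGroup K] {R : Set (Set α)}
    (hR : MeasureTheory.IsSetRing R) (μ : MeasureTheory.AddContent K R) {s t : Set α}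
    (hs : s ∈ R) (ht : t ∈ R) (hst : s ⊆ t) : μ (t \ s) = μ t - μ s := by
  rw [eq_sub_iff_add_eq, ← MeasureTheory.addContent_union hR (hR.sdiff_mem ht hs) hs
    Set.disjoint_sdiff_left, Set.sdiff_union_of_subset hst]

theorem smul_sdiff_union_zero {d : ℕ} (C : PointedCone ℝ (Fin d → ℝ)) {c : ℝ} (hc : 0 < c)
    (Δ : Set (Fin d → ℝ)) :
    c • ((C : Set (Fin d → ℝ)) \ (Δ ∪ {0})) = (C : Set (Fin d → ℝ)) \ (c • Δ ∪ {0}) := by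
  rw [Set.smul_set_sdiff₀ hc.ne', Set.smul_set_union, smul_coe_pointedCone C hc,
    Set.smul_set_singleton, smul_zero]

/-- In `ℝ^0` every coconvex sum is empty. -/
theorem bigOplus_eq_empty (C : PointedCone ℝ (Fin 0 → ℝ)) (n : ℕ)
    (A : Fin (n + 1) → Set (Fin 0 → ℝ)) (hA : ∀ i, A i = ∅) : bigOplus C n A = ∅ := by
  cases n with
  | zero => exact hA 0
  | succ n =>
    refine Set.eq_empty_of_forall_notMem fun x hx => hx.2 (Or.inr ?_)
    exact Subsingleton.elim x 0

/-- A Minkowski combination of coconvex integer polytopes is, up to the apex, the difference of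
Minkowski combinations of integer polytopes `D j ⊆ B j`. -/
theorem exists_bigOplus_eq {d : ℕ} [NeZero d] {C : PointedCone ℝ (Fin d → ℝ)}
    (hC : IsStrictlyConvexCone C) (hCint : IsIntegerCone C) (n : ℕ)
    (A : Fin (n + 1) → Set (Fin d → ℝ)) (hA : ∀ i, IsCoconvexIntegerPolytope C (A i)) :
    ∃ B D : Fin (n + 1) → Set (Fin d → ℝ),
      (∀ j, IsIntegerPolytope (B j) ∧ (B j).Nonempty ∧ IsIntegerPolytope (D j) ∧
        (D j).Nonempty ∧ D j ⊆ B j) ∧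
      ∀ m : Fin (n + 1) → ℕ, (∀ i, 0 < m i) →
        bigOplus C n (fun i => (m i : ℝ) • A i) =
          ((∑ j, (m j : ℝ) • B j) \ ∑ j, (m j : ℝ) • D j) \ {0} ∧
        (0 : Fin d → ℝ) ∈ (∑ j, (m j : ℝ) • B j) \ ∑ j, (m j : ℝ) • D j := by
  choose Δ hΔ hv hAΔ using hA
  obtain ⟨S, hS0, hCS⟩ := hCint.exists_family
  have hSne : Nonempty S := by
    by_contra hempty
    rw [not_nonempty_iff] at hempty
    have hbot : (C : Set (Fin d → ℝ)) = {0} := by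
      rw [hCS, Set.range_eq_empty]
      simp
    have hint := hC.interior_nonempty
    rw [hbot, interior_singleton] at hint
    exact Set.not_nonempty_empty hint
  have hz : ∀ i : S, (i : Fin d → ℤ) ≠ 0 := fun i h => hS0 (h ▸ i.2)
  obtain ⟨hP, B, D, hBD, h⟩ := exists_integerPolytopes_sdiff_eq hC hCS hz hSne hΔ hv
  obtain ⟨i₀⟩ := id hSne
  have hg : latticePoint (i₀ : Fin d → ℤ) ∈ C := by
    rw [hCS]
    exact Submodule.subset_span ⟨i₀, rfl⟩
  have hg0 : latticePoint (i₀ : Fin d → ℤ) ≠ 0 := fun h0 =>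
    hz i₀ (latticePoint_injective (h0.trans latticePoint_zero.symm))
  refine ⟨B, D, hBD, fun m hm => ?_⟩
  have hm' : ∀ i, (0 : ℝ) < m i := fun i => Nat.cast_pos.2 (hm i)
  obtain ⟨h1, h2, -⟩ := bigOplus_eq_sdiff hC hg hg0 n (fun i => (m i : ℝ) • Δ i)
    (fun i => (hΔ i).smul (hm' i)) fun i => by
      obtain ⟨P, hPc, hPe⟩ := hP i
      refine ⟨(m i : ℝ) • P, hPc.smul _, ?_⟩
      rw [hPe, smul_add, smul_coe_pointedCone C (hm' i)]
  have h3 := h (fun i => (m i : ℝ)) hm'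
  rw [← h3]
  refine ⟨?_, C.zero_mem, h2.zero_notMem⟩
  rw [Set.sdiff_sdiff, ← h1]
  congr 1
  ext1 i
  rw [hAΔ i, smul_sdiff_union_zero C (hm' i)]

end Coconvex

theorem mainTheorem4 {d : ℕ} {K : Type*} [Field K] [CharZero K]
    (k : ℕ) (μ : Coconvex.IntegerValuation d K) (hμ : μ.IsPolynomial k)
    (C : PointedCone ℝ (Fin d → ℝ))
    (hC : Coconvex.IsStrictlyConvexCone C) (hCint : Coconvex.IsIntegerCone C)
    (n : ℕ) (A : Fin (n + 1) → Set (Fin d → ℝ))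
    (hA : ∀ i, Coconvex.IsCoconvexIntegerPolytope C (A i)) :
    (∀ m : Fin (n + 1) → ℕ, (∀ i, 0 < m i) →
      Coconvex.bigOplus C n (fun i => (m i : ℝ) • A i) ∈ Coconvex.integerPolytopeRing d) ∧
    ∃ E : MvPolynomial (Fin (n + 1)) K, E.totalDegree ≤ k + d ∧
      ∀ m : Fin (n + 1) → ℕ, (∀ i, 0 < m i) →
        μ (Coconvex.bigOplus C n (fun i => (m i : ℝ) • A i)) =
          MvPolynomial.eval (fun i => (m i : K)) E := by
  have hR := Coconvex.isSetRing_integerPolytopeRing d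
  rcases Nat.eq_zero_or_pos d with rfl | hd
  · have hempty : ∀ m : Fin (n + 1) → ℕ,
        Coconvex.bigOplus C n (fun i => (m i : ℝ) • A i) = ∅ := by
      refine fun m => Coconvex.bigOplus_eq_empty C n _ fun i => ?_
      obtain ⟨Δ, -, -, hAΔ⟩ := hA i
      have hAi : A i = ∅ := by
        refine Set.eq_empty_of_forall_notMem fun x hx => ?_
        rw [hAΔ] at hx
        exact hx.2 (Or.inr (Subsingleton.elim x 0))
      rw [hAi, Set.smul_set_empty]
    refine ⟨fun m _ => hempty m ▸ hR.empty_mem, 0, by simp, fun m _ => ?_⟩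
    rw [hempty, MeasureTheory.addContent_empty, map_zero]
  · have : NeZero d := ⟨hd.ne'⟩
    obtain ⟨B, D, hBD, h⟩ := Coconvex.exists_bigOplus_eq hC hCint n A hA
    have hBint : ∀ m : Fin (n + 1) → ℕ,
        ∑ j, (m j : ℝ) • B j ∈ Coconvex.integerPolytopeRing d := fun m =>
      (Coconvex.IsIntegerPolytope.sum _ _ fun j _ => (hBD j).1.nsmul _).mem_ring
    have hDint : ∀ m : Fin (n + 1) → ℕ,
        ∑ j, (m j : ℝ) • D j ∈ Coconvex.integerPolytopeRing d := fun m =>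
      (Coconvex.IsIntegerPolytope.sum _ _ fun j _ => (hBD j).2.2.1.nsmul _).mem_ring
    have h0int : ({0} : Set (Fin d → ℝ)) ∈ Coconvex.integerPolytopeRing d := by
      have := (Coconvex.isIntegerPolytope_singleton (0 : Fin d → ℤ)).mem_ring
      rwa [Coconvex.latticePoint_zero] at this
    obtain ⟨EB, hEB, hB⟩ := Coconvex.exists_mvPolynomial_minkowski hμ B
      (fun j => (hBD j).1) fun j => (hBD j).2.1
    obtain ⟨ED, hED, hD⟩ := Coconvex.exists_mvPolynomial_minkowski hμ D
      (fun j => (hBD j).2.2.1) fun j => (hBD j).2.2.2.1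
    refine ⟨fun m hm => ?_, EB - ED - MvPolynomial.C (μ {0}), ?_, fun m hm => ?_⟩
    · rw [(h m hm).1]
      exact hR.sdiff_mem (hR.sdiff_mem (hBint m) (hDint m)) h0int
    · refine (MvPolynomial.totalDegree_sub _ _).trans (max_le ?_ ?_)
      · exact (MvPolynomial.totalDegree_sub _ _).trans (max_le hEB hED)
      · rw [MvPolynomial.totalDegree_C]
        exact Nat.zero_le _
    · have hsub : ∑ j, (m j : ℝ) • D j ⊆ ∑ j, (m j : ℝ) • B j :=
        Set.finsetSum_subset_finsetSum _ _ _ fun j _ => Set.smul_set_mono (hBD j).2.2.2.2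
      rw [(h m hm).1, Coconvex.addContent_sdiff_eq_sub hR μ h0int
          (hR.sdiff_mem (hBint m) (hDint m)) (Set.singleton_subset_iff.2 (h m hm).2),
        Coconvex.addContent_sdiff_eq_sub hR μ (hDint m) (hBint m) hsub, hB, hD, map_sub, map_sub,
        MvPolynomial.eval_C]
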